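/- **Blindness of the polynomial-based QPIP.** Let $q$ be a prime, $d\ge 0$, $m=2d+1$, let $\alpha_1,\dots,\alpha_m\in F_q$ be distinct and non-zero, and let $c_i=\prod_{j\neq i}\frac{-\alpha_j}{\alpha_i-\alpha_j}$. Over $q$-dimensional qudits put $X|a\rangle=|a+1\rangle$, $Z|a\rangle=e^{2\pi i a/q}|a\rangle$, $F|a\rangle=q^{-1/2}\sum_b e^{2\pi i ab/q}|b\rangle$, $SUM|a,b\rangle=|a,a+b\rangle$, $T|a,b,c\rangle=|a,b,c+ab\rangle$. For a sign key $k\in\{\pm1\}^m$ let $|S^k_a\rangle=q^{-d/2}\sum_{\deg f\le d,\,f(0)=a}|k_1f(\alpha_1),\dots,k_mf(\alpha_m)\rangle$, and let $D_k$ be the permutation of $F_q^m$ that sends $(b_1,\dots,b_m)$ to $(k_1f(\alpha_1),\,b_2,\dots,b_{d+1},\,b_{d+2}+k_{d+2}f(\alpha_{d+2}),\dots,b_m+k_mf(\alpha_m))$, where $f$ is the polynomial of degree $\le d$ with $f(0)=b_1$ and $k_if(\alpha_i)=b_i$ for $2\le i\le d+1$. Let $U=A_LT_L\cdots A_1T_1A_0$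 be a circuit on $n\ge1$ qudits, where each $A_i$ is a product of gates $X^a$, $Z^a$, $F^{\pm1}$, $SUM^r$ and each $T_i$ is a Toffoli gate on three different qudits. Consider the following protocol. *Round 0.* The verifier draws uniformly a sign key $k\in\{\pm1\}^m$ and independent Pauli keys $(x,z)$, $x,z\in F_q^m$, one pair for each of $n+3L$ blocks of $m$ qudits. He takes an $n$-qudit input state $\rho$ and $L$ Toffoli states $\frac1q\sum_{a,b}|a,b,ab\rangle$, encodes every qudit by $|a\rangle\mapsto|S_a^k\rangle$, applies $Z^{z_1}X^{x_1}\otimes\cdots\otimes Z^{z_m}X^{x_m}$ to each block, and sends all blocks to the prover. *Key updates.* For a logical Clifford gate the verifier updates his Pauli keys: $X^a$: $x_i\mapsto x_i-ak_i$; $Z^a$: $z_i\mapsto z_i-ac_ik_i$; $F$: $(x_i,z_i)\mapsto(-c_i^{-1}z_i,c_ix_i)$; $F^{-1}$: the inverse map; $SUM^r$ from block $A$ to block $B$: $z_A\mapsto z_A-rz_B$, $x_B\mapsto x_B+rx_A$. In round 0 he does so for the gates of $A_0$. *Round $i$, $1\le i\le L$.* Let registers 4, 5, 6 be the blocks that currently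 carry the three qudits of $T_i$, and registers 1, 2, 3 the $i$-th Toffoli state. The verifier updates his keys for $SUM_{6,3}$, $SUM_{1,4}^{-1}$, $SUM_{2,5}^{-1}$, $F_6^{-1}$. The prover measures registers 4, 5, 6 in the standard basis and sends the three strings $s\in F_q^m$ to the verifier. From each string the verifier removes the current Pauli key ($s\mapsto s-x$), applies $D_k^{-1}$, and sends the first coordinate of the result back to the prover; the three values form $\beta_i=(x,y,z)\in F_q^3$. He then updates his keys for the correction $C_{x,y,z}=(X^xZ^{-yz}\otimes X^yZ^{-xz}\otimes X^{xy}Z^z)\,SUM_{1,3}^{y}\,SUM_{2,3}^{x}\,CPG_{1,2}^{-z}$ on registers 1, 2, 3, where $CPG_{1,2}^{-z}=F_2\,SUM_{1,2}^{-z}\,F_2^{-1}$; registers 1, 2, 3 now carry the three qudits of $T_i$, and he updates his keys for the gates of $A_i$. *Round $L+1$.* The prover measures the block that carries the first qudit and sends the resulting string; he gets no answer. The prover is arbitrary: he has an environment of any finite dimension in an initial state $\rho_{\mathcal E}$ that is independent of $\rho$, and at the end of each of the rounds $0,\dots,L$ he applies an arbitrary unitary, which may depend on the classical messages exchanged so far,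 to his environment and all qudits that he received. (The gates of an honest prover are a special case.) Then the prover's state remains independent of the input throughout the protocol. That is, for every prover and any two $n$-qudit density matrices $\rho,\rho'$, the joint state, averaged over the verifier's secret keys, of all classical messages sent and received by the prover so far and of all quantum registers of the prover (the received qudits, including those already measured, and the environment) is the same for input $\rho$ as for input $\rho'$: at the end of each of the rounds $0,\dots,L$, after each sending of measured strings and before the verifier's answer, and after the final round. -/

import Mathlib

open scoped Kronecker Matrix ComplexOrder

noncomputable section

namespace PolyQPIP

/-! ### The signed polynomial code over `F_q`, of degree `d` and length `m = 2 d + 1` -/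

/-- Distinct non-zero evaluation points `α₁, …, α_m` of `F_q`, where `m = 2 d + 1`. -/
structure EvalPoints (q d : ℕ) where
  pt : Fin (2 * d + 1) → ZMod q
  inj : Function.Injective pt
  ne_zero : ∀ i, pt i ≠ 0

/-- A string of `F_q^m`: the standard basis label of one block of `m` qudits. -/
abbrev Word (q d : ℕ) := Fin (2 * d + 1) → ZMod q

/-- Sign keys `k ∈ {-1, 1}^m`. -/
abbrev SignKey (d : ℕ) := Fin (2 * d + 1) → ℤˣ

/-- The `i`-th sign, as an element of `F_q`. -/
def sgn (q : ℕ) {d : ℕ} (k : SignKey d) (i : Fin (2 * d + 1)) : ZMod q := ((k i : ℤ) : ZMod q)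

theorem sgn_mul_self (q : ℕ) {d : ℕ} (k : SignKey d) (i : Fin (2 * d + 1)) :
    sgn q k i * sgn q k i = 1 := by
  unfold sgn
  rcases Int.units_eq_one_or (k i) with h | h <;> simp [h]

section Code

variable {q d : ℕ} [Fact q.Prime]

/-- The signed polynomial code state
`|S_a^k⟩ = q^{-d/2} ∑_{deg f ≤ d, f(0) = a} |k₁ f(α₁), …, k_m f(α_m)⟩`, as a vector of
amplitudes; the polynomial `f = ∑ⱼ cⱼ Xʲ` is given by its coefficients. -/
def codeState (pts : EvalPoints q d) (k : SignKey d) (a : ZMod q) : Word q d → ℂ :=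
  ((Real.sqrt ((q : ℝ) ^ d) : ℝ) : ℂ)⁻¹ •
    ∑ c : Fin (d + 1) → ZMod q,
      if c 0 = a then
        Pi.single (fun i => sgn q k i * ∑ j, c j * pts.pt i ^ (j : ℕ)) (1 : ℂ)
      else 0

/-- The interpolation coefficients `c_i`, with `∑ᵢ cᵢ f(αᵢ) = f(0)` for `deg f ≤ m - 1`. -/
def interpCoeff (pts : EvalPoints q d) (i : Fin (2 * d + 1)) : ZMod q :=
  ∏ j ∈ Finset.univ.erase i, (-pts.pt j) / (pts.pt i - pts.pt j)

/-- The first `d + 1` of the `m = 2 d + 1` positions. -/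
def headPos (d : ℕ) : Finset (Fin (2 * d + 1)) := Finset.univ.filter fun i => (i : ℕ) ≤ d

/-- The nodes `0, α₂, …, α_m`. -/
def zeroNodes (pts : EvalPoints q d) : Word q d := Function.update pts.pt 0 0

/-- The polynomial `f` of degree at most `d` with `f(0) = b₁` and `kᵢ f(αᵢ) = bᵢ` for
`2 ≤ i ≤ d + 1`. -/
def polyOfData (pts : EvalPoints q d) (k : SignKey d) (b : Word q d) : Polynomial (ZMod q) :=
  Lagrange.interpolate (headPos d) (zeroNodes pts) fun i => if i = 0 then b i else sgn q k i * b i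

/-- The polynomial `f` of degree at most `d` with `kᵢ f(αᵢ) = yᵢ` for `1 ≤ i ≤ d + 1`. -/
def polyOfWord (pts : EvalPoints q d) (k : SignKey d) (y : Word q d) : Polynomial (ZMod q) :=
  Lagrange.interpolate (headPos d) pts.pt fun i => sgn q k i * y i

/-- The action on basis strings of the interpolation circuit `D_k`: the first coordinate `b₁`
becomes `k₁ f(α₁)`, coordinates `2, …, d + 1` are kept, and `k_j f(α_j)` is added to each
coordinate `j ≥ d + 2`, where `f` is the polynomial with `f(0) = b₁` and `kᵢ f(αᵢ) = bᵢ` for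
`2 ≤ i ≤ d + 1`. -/
def interpMap (pts : EvalPoints q d) (k : SignKey d) (b : Word q d) : Word q d := fun i =>
  if i = 0 then sgn q k i * (polyOfData pts k b).eval (pts.pt i)
  else if (i : ℕ) ≤ d then b i
  else b i + sgn q k i * (polyOfData pts k b).eval (pts.pt i)

/-- The action on basis strings of `D_k†`. -/
def uninterpMap (pts : EvalPoints q d) (k : SignKey d) (y : Word q d) : Word q d := fun i =>
  if i = 0 then (polyOfWord pts k y).eval 0
  else if (i : ℕ) ≤ d then y i
  else y i - sgn q k i * (polyOfWord pts k y).eval (pts.pt i)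

theorem zero_mem_headPos (d : ℕ) : (0 : Fin (2 * d + 1)) ∈ headPos d := by simp [headPos]

theorem zeroNodes_zero (pts : EvalPoints q d) : zeroNodes pts 0 = 0 := by simp [zeroNodes]

theorem zeroNodes_of_ne (pts : EvalPoints q d) {i : Fin (2 * d + 1)} (h : i ≠ 0) :
    zeroNodes pts i = pts.pt i := by simp [zeroNodes, h]

theorem zeroNodes_injective (pts : EvalPoints q d) : Function.Injective (zeroNodes pts) := by
  intro i j hij
  by_cases hi : i = 0 <;> by_cases hj : j = 0
  · rw [hi, hj]
  · rw [hi, zeroNodes_zero, zeroNodes_of_ne pts hj] at hij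
    exact absurd hij.symm (pts.ne_zero j)
  · rw [hj, zeroNodes_zero, zeroNodes_of_ne pts hi] at hij
    exact absurd hij (pts.ne_zero i)
  · rw [zeroNodes_of_ne pts hi, zeroNodes_of_ne pts hj] at hij
    exact pts.inj hij

theorem polyOfWord_interpMap (pts : EvalPoints q d) (k : SignKey d) (b : Word q d) :
    polyOfWord pts k (interpMap pts k b) = polyOfData pts k b := by
  refine (Lagrange.eq_interpolate_of_eval_eq _ pts.inj.injOn
    (Lagrange.degree_interpolate_lt _ (zeroNodes_injective pts).injOn) ?_).symm
  intro i hi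
  have hi' : (i : ℕ) ≤ d := by simpa [headPos] using hi
  by_cases h : i = 0
  · simp only [interpMap, h, if_true]
    rw [← mul_assoc, sgn_mul_self, one_mul, polyOfData]
  · have := Lagrange.eval_interpolate_at_node
      (fun i => if i = 0 then b i else sgn q k i * b i) (zeroNodes_injective pts).injOn hi
    rw [zeroNodes_of_ne pts h] at this
    simpa [interpMap, h, hi', polyOfData] using this

theorem polyOfData_uninterpMap (pts : EvalPoints q d) (k : SignKey d) (y : Word q d) :
    polyOfData pts k (uninterpMap pts k y) = polyOfWord pts k y := by
  refine (Lagrange.eq_interpolate_of_eval_eq _ (zeroNodes_injective pts).injOn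
    (Lagrange.degree_interpolate_lt _ pts.inj.injOn) ?_).symm
  intro i hi
  have hi' : (i : ℕ) ≤ d := by simpa [headPos] using hi
  by_cases h : i = 0
  · simp only [h, uninterpMap, zeroNodes_zero, if_true]
    rw [polyOfWord]
  · have := Lagrange.eval_interpolate_at_node
      (fun i => sgn q k i * y i) pts.inj.injOn hi
    rw [zeroNodes_of_ne pts h]
    simpa [uninterpMap, h, hi', polyOfWord] using this

/-- `D_k`, as a permutation of the basis strings. -/
def interpEquiv (pts : EvalPoints q d) (k : SignKey d) : Word q d ≃ Word q d where
  toFun := interpMap pts k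
  invFun := uninterpMap pts k
  left_inv b := by
    funext i
    by_cases h : i = 0
    · subst h
      have := Lagrange.eval_interpolate_at_node
        (fun i => if i = 0 then b i else sgn q k i * b i) (zeroNodes_injective pts).injOn
        (zero_mem_headPos d)
      rw [zeroNodes_zero] at this
      simpa [uninterpMap, polyOfWord_interpMap, polyOfData] using this
    · by_cases hd : (i : ℕ) ≤ d <;> simp [uninterpMap, interpMap, h, hd, polyOfWord_interpMap]
  right_inv y := by
    funext i
    by_cases h : i = 0
    · subst h
      have := Lagrange.eval_interpolate_at_node
        (fun i => sgn q k i * y i) pts.inj.injOn (zero_mem_headPos d)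
      simp only [interpMap, polyOfData_uninterpMap, if_true]
      rw [polyOfWord, this, ← mul_assoc, sgn_mul_self, one_mul]
    · by_cases hd : (i : ℕ) ≤ d <;> simp [uninterpMap, interpMap, h, hd, polyOfData_uninterpMap]

end Code

/-! ### Circuits -/

/-- Clifford gates on qudits labelled by `ι`: powers of the Pauli gates `X` and `Z`, the Fourier
gate and its inverse, and powers of `SUM` (from control `i` to target `j`). -/
inductive CliffordGate (q : ℕ) (ι : Type) : Type
  | pauliX (a : ZMod q) (i : ι)
  | pauliZ (a : ZMod q) (i : ι)
  | fourier (i : ι)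
  | fourierInv (i : ι)
  | sum (r : ZMod q) (i j : ι)

namespace CliffordGate

/-- A gate is well formed if a `SUM` acts on two different qudits. -/
def WellFormed {q : ℕ} {ι : Type} : CliffordGate q ι → Prop
  | sum _ i j => i ≠ j
  | _ => True

/-- Relabelling of the qudits on which a gate acts. -/
def map {q : ℕ} {ι κ : Type} (f : ι → κ) : CliffordGate q ι → CliffordGate q κ
  | pauliX a i => pauliX a (f i)
  | pauliZ a i => pauliZ a (f i)
  | fourier i => fourier (f i)
  | fourierInv i => fourierInv (f i)
  | sum r i j => sum r (f i) (f j)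

end CliffordGate

/-- A circuit `U = A_L T_L ⋯ A_1 T_1 A_0` on `n` qudits of dimension `q`, where the `A_i` are
Clifford circuits (lists of gates, the first gate being applied first) and each `T_i` is a
Toffoli gate `|a, b, c⟩ ↦ |a, b, c + ab⟩` on three different qudits. -/
structure Circuit (q n L : ℕ) where
  clifford : Fin (L + 1) → List (CliffordGate q (Fin n))
  wellFormed : ∀ i, ∀ g ∈ clifford i, g.WellFormed
  toffoli : Fin L → (Fin 3 ↪ Fin n)

/-- The authenticated qudits sent to the prover: `n` input qudits, and `L` Toffoli states of three
qudits each. Each is encoded in a block of `m` qudits. -/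
abbrev Block (n L : ℕ) := Fin n ⊕ Fin L × Fin 3

/-- The block that carries each qudit of the circuit after the first `i` Toffoli gates:
teleportation through the `i`-th Toffoli state moves the three qudits of the `i`-th Toffoli gate
to the blocks of that state. -/
def loc {q n L : ℕ} (C : Circuit q n L) : (i : ℕ) → i ≤ L → Fin n → Block n L
  | 0, _, w => Sum.inl w
  | i + 1, hi, w =>
    if w = C.toffoli ⟨i, hi⟩ 0 then Sum.inr (⟨i, hi⟩, 0)
    else if w = C.toffoli ⟨i, hi⟩ 1 then Sum.inr (⟨i, hi⟩, 1)
    else if w = C.toffoli ⟨i, hi⟩ 2 then Sum.inr (⟨i, hi⟩, 2)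
    else loc C i (Nat.le_of_succ_le hi) w

/-- The three blocks that are measured for the `(i+1)`-st Toffoli gate. -/
def measuredBlock {q n L : ℕ} (C : Circuit q n L) (i : ℕ) (hi : i < L) (j : Fin 3) : Block n L :=
  loc C i hi.le (C.toffoli ⟨i, hi⟩ j)

/-- The gates of the Clifford circuit between the `i`-th and the `(i+1)`-st Toffoli gate, on the
blocks that carry its qudits. -/
def cliffordGates {q n L : ℕ} (C : Circuit q n L) (i : ℕ) (hi : i ≤ L) :
    List (CliffordGate q (Block n L)) :=
  (C.clifford ⟨i, Nat.lt_succ_of_le hi⟩).map fun g => g.map (loc C i hi)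

/-- The gates that entangle the next Toffoli state with the three qudits of the Toffoli gate. With
the Toffoli state in registers 1, 2, 3 and the qudits of the gate in registers 4, 5, 6: `SUM` from
6 to 3, inverse `SUM` from 1 to 4 and from 2 to 5, inverse Fourier on 6. -/
def entanglingGates {q n L : ℕ} (C : Circuit q n L) (i : ℕ) (hi : i < L) :
    List (CliffordGate q (Block n L)) :=
  [ .sum 1 (measuredBlock C i hi 2) (Sum.inr (⟨i, hi⟩, 2)),
    .sum (-1) (Sum.inr (⟨i, hi⟩, 0)) (measuredBlock C i hi 0),
    .sum (-1) (Sum.inr (⟨i, hi⟩, 1)) (measuredBlock C i hi 1),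
    .fourierInv (measuredBlock C i hi 2) ]

/-- The correction `C_{x,y,z} = (X^x Z^{-yz} ⊗ X^y Z^{-xz} ⊗ X^{xy} Z^z) SUM_{1,3}^y SUM_{2,3}^x
CPG_{1,2}^{-z}` on the three registers of the Toffoli state, for the measurement result
`β = (x, y, z)`. The gate `CPG_{1,2}^{-z}` is `F_2 SUM_{1,2}^{-z} F_2⁻¹`. -/
def correctionGates {q n L : ℕ} (i : Fin L) (β : Fin 3 → ZMod q) :
    List (CliffordGate q (Block n L)) :=
  [ .fourierInv (Sum.inr (i, 1)),
    .sum (-β 2) (Sum.inr (i, 0)) (Sum.inr (i, 1)),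
    .fourier (Sum.inr (i, 1)),
    .sum (β 0) (Sum.inr (i, 1)) (Sum.inr (i, 2)),
    .sum (β 1) (Sum.inr (i, 0)) (Sum.inr (i, 2)),
    .pauliZ (-(β 1 * β 2)) (Sum.inr (i, 0)),
    .pauliX (β 0) (Sum.inr (i, 0)),
    .pauliZ (-(β 0 * β 2)) (Sum.inr (i, 1)),
    .pauliX (β 1) (Sum.inr (i, 1)),
    .pauliZ (β 2) (Sum.inr (i, 2)),
    .pauliX (β 0 * β 1) (Sum.inr (i, 2)) ]

/-! ### The verifier -/

/-- Pauli keys: the pair `(x, z)` stands for the Pauli operator with factor `Z^{z_{b,j}} X^{x_{b,j}}`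
on the `j`-th qudit of block `b`. -/
abbrev PauliKey (q n L d : ℕ) := (Block n L → Word q d) × (Block n L → Word q d)

/-- The secret key of the verifier: one sign key, and independent Pauli keys for all qudits. -/
abbrev Key (q n L d : ℕ) := SignKey d × PauliKey q n L d

section Protocol

variable {q n L d : ℕ} [Fact q.Prime]

/-- The update of the Pauli keys by which the verifier takes part in a logical Clifford gate. The
prover does nothing for `X` and `Z`, applies `F_{c_1} ⊗ ⋯ ⊗ F_{c_m}` for `F` (its inverse for
`F⁻¹`), and applies `SUM^r` to the `m` pairs of corresponding qudits for `SUM^r`. -/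
def updateKey (pts : EvalPoints q d) (k : SignKey d) :
    CliffordGate q (Block n L) → PauliKey q n L d → PauliKey q n L d
  | .pauliX a b, (x, z) => (Function.update x b fun i => x b i - a * sgn q k i, z)
  | .pauliZ a b, (x, z) =>
      (x, Function.update z b fun i => z b i - a * (interpCoeff pts i * sgn q k i))
  | .fourier b, (x, z) =>
      (Function.update x b fun i => -((interpCoeff pts i)⁻¹ * z b i),
        Function.update z b fun i => interpCoeff pts i * x b i)
  | .fourierInv b, (x, z) =>
      (Function.update x b fun i => (interpCoeff pts i)⁻¹ * z b i,
        Function.update z b fun i => -(interpCoeff pts i * x b i))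
  | .sum r a b, (x, z) =>
      (Function.update x b fun i => x b i + r * x a i,
        Function.update z a fun i => z a i - r * z b i)

/-- Key updates for a list of gates, the first gate being applied first. -/
def updateKeys (pts : EvalPoints q d) (k : SignKey d) (gs : List (CliffordGate q (Block n L)))
    (p : PauliKey q n L d) : PauliKey q n L d :=
  gs.foldl (fun p g => updateKey pts k g p) p

/-- What is exchanged in one of the rounds `1, …, L`: the measured strings that the prover sends for
the three blocks, and the decoded measurement result in `F_q^3` that the verifier returns. -/
abbrev Exchange (q d : ℕ) := (Fin 3 → Word q d) × (Fin 3 → ZMod q)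

/-- The messages of rounds `1, …, i`. -/
abbrev Transcript (q d i : ℕ) := Fin i → Exchange q d

/-- The current Pauli keys of the verifier after `i` rounds, just after the Clifford circuit `A_i`. -/
def currentKey (pts : EvalPoints q d) (C : Circuit q n L) (κ : Key q n L d) :
    (i : ℕ) → i ≤ L → Transcript q d i → PauliKey q n L d
  | 0, hi, _ => updateKeys pts κ.1 (cliffordGates C 0 hi) κ.2
  | i + 1, hi, h =>
    updateKeys pts κ.1
      (entanglingGates C i hi ++ correctionGates ⟨i, hi⟩ (h (Fin.last i)).2 ++
        cliffordGates C (i + 1) hi)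
      (currentKey pts C κ i (Nat.le_of_succ_le hi) (Fin.init h))

/-- The verifier's decoding of the string `s` measured on block `b`: he removes the Pauli key and
applies `D_k†`. (Phases do not act on basis strings, and `(X^x)†` maps `|s⟩` to `|s - x⟩`.) -/
def decode (pts : EvalPoints q d) (k : SignKey d) (p : PauliKey q n L d) (b : Block n L)
    (s : Word q d) : Word q d :=
  (interpEquiv pts k).symm fun i => s i - p.1 b i

/-- The verifier's answer in round `i + 1`, after the transcript `h` of the first `i` rounds and the
measured strings `s`: the first coordinates of the three decoded strings. -/
def reply (pts : EvalPoints q d) (C : Circuit q n L) (κ : Key q n L d) (i : ℕ) (hi : i < L)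
    (h : Transcript q d i) (s : Fin 3 → Word q d) : Fin 3 → ZMod q := fun j =>
  decode pts κ.1 (updateKeys pts κ.1 (entanglingGates C i hi) (currentKey pts C κ i hi.le h))
    (measuredBlock C i hi j) (s j) 0

/-! ### Quantum states -/

/-- Density matrices: positive semidefinite of trace one. -/
def IsDensity {ι : Type*} [Fintype ι] (ρ : Matrix ι ι ℂ) : Prop := ρ.PosSemidef ∧ ρ.trace = 1

/-- Basis labels of the qudits sent to the prover: `m (n + 3 L)` qudits, in blocks of `m`. -/
abbrev Reg (q n L d : ℕ) := Block n L → Word q d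

/-- The Toffoli state `q⁻¹ ∑_{a,b} |a, b, ab⟩`. -/
def toffoliState (q : ℕ) (v : Fin 3 → ZMod q) : ℂ := if v 2 = v 0 * v 1 then (q : ℂ)⁻¹ else 0

/-- The state of the `n` input qudits together with `L` Toffoli states, before authentication. -/
def logicalState (L : ℕ) (ρ : Matrix (Fin n → ZMod q) (Fin n → ZMod q) ℂ) :
    Matrix (Block n L → ZMod q) (Block n L → ZMod q) ℂ :=
  Matrix.of fun u v => ρ (fun w => u (Sum.inl w)) (fun w => v (Sum.inl w)) *
    ∏ t : Fin L, toffoliState q (fun j => u (Sum.inr (t, j))) *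
      star (toffoliState q (fun j => v (Sum.inr (t, j))))

/-- The encoding isometry, `|a⟩ ↦ |S_a^k⟩ = E_k |a⟩|0⟩^{m-1}` on each block, with the same sign key
on all blocks. -/
def encode (pts : EvalPoints q d) (k : SignKey d) :
    Matrix (Reg q n L d) (Block n L → ZMod q) ℂ :=
  Matrix.of fun y a => ∏ b, codeState pts k (a b) (y b)

/-- The encoded state `ρ^k` of the input together with the Toffoli states. -/
def encodedState (pts : EvalPoints q d) (k : SignKey d)
    (ρ : Matrix (Fin n → ZMod q) (Fin n → ZMod q) ℂ) :
    Matrix (Reg q n L d) (Reg q n L d) ℂ :=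
  let W : Matrix (Reg q n L d) (Block n L → ZMod q) ℂ := encode pts k
  W * logicalState L ρ * W.conjTranspose

/-- The Pauli operator of a Pauli key: `|y⟩ ↦ ω^{z·(y+x)} |y + x⟩`, the tensor product of the
operators `Z^z X^x`, where `ω = e^{2πi/q}`, `X |a⟩ = |a + 1⟩` and `Z |a⟩ = ω^a |a⟩`. -/
def pauli (p : PauliKey q n L d) : Matrix (Reg q n L d) (Reg q n L d) ℂ :=
  Matrix.of fun y' y =>
    if y' = y + p.1 then ZMod.stdAddChar (∑ b, ∑ i, p.2 b i * y' b i) else 0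

/-- The authenticated state that the verifier sends, for a fixed key. -/
def authenticated (pts : EvalPoints q d) (κ : Key q n L d)
    (ρ : Matrix (Fin n → ZMod q) (Fin n → ZMod q) ℂ) :
    Matrix (Reg q n L d) (Reg q n L d) ℂ :=
  pauli κ.2 * encodedState pts κ.1 ρ * (pauli κ.2).conjTranspose

variable {E : Type*} [Fintype E] [DecidableEq E]

/-- The projection onto `|s⟩⟨s|` on the three blocks measured for the `(i+1)`-st Toffoli gate. -/
def measureProj (C : Circuit q n L) (i : ℕ) (hi : i < L) (s : Fin 3 → Word q d) :
    Matrix (Reg q n L d × E) (Reg q n L d × E) ℂ :=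
  Matrix.diagonal fun ye => if ∀ j, ye.1 (measuredBlock C i hi j) = s j then 1 else 0

/-- The projection onto `|s⟩⟨s|` on the block of the first qudit of the circuit's output. -/
def finalProj [NeZero n] (C : Circuit q n L) (s : Word q d) :
    Matrix (Reg q n L d × E) (Reg q n L d × E) ℂ :=
  Matrix.diagonal fun ye => if ye.1 (loc C L le_rfl 0) = s then 1 else 0

/-- A strategy of an arbitrary (unbounded, possibly dishonest) prover: for each `i` and each
transcript of the first `i` rounds, the unitary that he applies at the end of round `i` to all
qudits that he received and to his environment `E`. The logical Clifford gates that an honest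
prover applies are part of this unitary. -/
def Strategy (q n L d : ℕ) [Fact q.Prime] (E : Type*) [Fintype E] [DecidableEq E] :=
  (i : ℕ) → Transcript q d i → Matrix.unitaryGroup (Reg q n L d × E) ℂ

/-- The state of the prover at the end of round `i`, for a fixed key `κ`, on the event that the
transcript of rounds `1, …, i` is `h`; it is not normalized, its trace being the probability of
`h`. In round 0 he receives the authenticated state; in round `i + 1` he measures three blocks,
sends the result, and gets the verifier's answer. The measured blocks stay with him. -/
def runWithKey (pts : EvalPoints q d) (C : Circuit q n L) (V : Strategy q n L d E)
    (ρE : Matrix E E ℂ) (ρ : Matrix (Fin n → ZMod q) (Fin n → ZMod q) ℂ) (κ : Key q n L d) :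
    (i : ℕ) → i ≤ L → Transcript q d i → Matrix (Reg q n L d × E) (Reg q n L d × E) ℂ
  | 0, _, h =>
    (V 0 h).1 * (authenticated pts κ ρ ⊗ₖ ρE) * (V 0 h).1ᴴ
  | i + 1, hi, h =>
    if (h (Fin.last i)).2 = reply pts C κ i hi (Fin.init h) (h (Fin.last i)).1 then
      (V (i + 1) h).1 *
        (measureProj C i hi (h (Fin.last i)).1 *
          runWithKey pts C V ρE ρ κ i (Nat.le_of_succ_le hi) (Fin.init h) *
          (measureProj C i hi (h (Fin.last i)).1)ᴴ) *
        (V (i + 1) h).1ᴴ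
    else 0

/-- The state of the prover at the end of round `i` (`0 ≤ i ≤ L`), averaged over the uniformly
random secret key. The prover's joint classical and quantum state is the family of these matrices,
`∑_h |h⟩⟨h| ⊗ proverState … h`. -/
def proverState (pts : EvalPoints q d) (C : Circuit q n L) (V : Strategy q n L d E)
    (ρE : Matrix E E ℂ) (ρ : Matrix (Fin n → ZMod q) (Fin n → ZMod q) ℂ)
    (i : ℕ) (hi : i ≤ L) (h : Transcript q d i) :
    Matrix (Reg q n L d × E) (Reg q n L d × E) ℂ :=
  (Fintype.card (Key q n L d) : ℂ)⁻¹ • ∑ κ, runWithKey pts C V ρE ρ κ i hi h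

/-- The state of the prover after he has measured the three blocks of round `i + 1` and has sent the
result `s`, before the verifier answers. -/
def proverStateSent (pts : EvalPoints q d) (C : Circuit q n L) (V : Strategy q n L d E)
    (ρE : Matrix E E ℂ) (ρ : Matrix (Fin n → ZMod q) (Fin n → ZMod q) ℂ)
    (i : ℕ) (hi : i < L) (h : Transcript q d i) (s : Fin 3 → Word q d) :
    Matrix (Reg q n L d × E) (Reg q n L d × E) ℂ :=
  measureProj C i hi s * proverState pts C V ρE ρ i hi.le h * (measureProj C i hi s)ᴴ

/-- The state of the prover after the final round `L + 1`, in which he measures the first qudit of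
the output and sends the result `s`; the verifier does not answer. -/
def proverStateFinal [NeZero n] (pts : EvalPoints q d) (C : Circuit q n L)
    (V : Strategy q n L d E) (ρE : Matrix E E ℂ)
    (ρ : Matrix (Fin n → ZMod q) (Fin n → ZMod q) ℂ) (h : Transcript q d L) (s : Word q d) :
    Matrix (Reg q n L d × E) (Reg q n L d × E) ℂ :=
  finalProj C s * proverState pts C V ρE ρ L le_rfl h * (finalProj C s)ᴴ

end Protocol

end PolyQPIP

end

/-!
For a fixed sign key and a fixed transcript the prover applies a linear map, independent of the Pauli
keys, to the authenticated state; the keys enter otherwise only through the condition that the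
recorded answers are those of the verifier. Blindness thus says that the sum of the authenticated
states over the Pauli keys consistent with a transcript does not depend on the input.

The verifier decodes by a linear functional `secret` and updates his keys by affine maps, so every
answer is an affine function of the initial Pauli keys (`exists_reply_eq`). Expanding the consistency
conditions in additive characters turns the sum into twirls `∑ p, ω ^ f p • P_p ρ P_p†` with linear
functionals `f`. Such a twirl depends on `ρ` only through the expectation of the Pauli operator dual
to `f` (`sum_authenticated_apply`), which for `f = 0` is a multiple of the trace.

For `f ≠ 0`, take the last round whose answer occurs in `f`. Until that round its Toffoli state was
touched by no gate, so the dual operator acts on that state as a tensor product of `Z`-type operators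
on the first two blocks and an `X`-type operator on the third, not all trivial. On the code the first
two are logical phases (`overlap_phase`), and the third, if it is not trivial, maps every code state
to an orthogonal one (`overlap_shift_self`), by a root count (`ne_zero_of_codeword_eq`). The
expectation of such an operator in `∑ |a, b, ab⟩` is zero (`sum_toffoliState_eq_zero`): the first two
labels determine the third, so that a shift of the third alone gives zero, and a non-trivial phase
averages to zero over the first two labels. The induction over the rounds is
`sum_consistent_authenticated_eq`.
-/

noncomputable section

namespace PolyQPIP

/-! ### The decoding functional and the overlaps of code states -/

section CodeLemmas

variable {q d : ℕ} [Fact q.Prime]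

/-- The value at `0` of the polynomial of degree at most `d` that interpolates the first `d + 1`
letters of a string with signs removed, as a linear functional: the logical value that the
verifier decodes. -/
def secret (pts : EvalPoints q d) (k : SignKey d) : Word q d →ₗ[ZMod q] ZMod q :=
  Polynomial.leval 0 ∘ₗ Lagrange.interpolate (headPos d) pts.pt ∘ₗ
    LinearMap.pi fun i => sgn q k i • LinearMap.proj i

theorem secret_apply (pts : EvalPoints q d) (k : SignKey d) (y : Word q d) :
    secret pts k y = (polyOfWord pts k y).eval 0 := rfl

theorem interpEquiv_symm_zero (pts : EvalPoints q d) (k : SignKey d) (y : Word q d) :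
    (interpEquiv pts k).symm y 0 = secret pts k y := by
  change uninterpMap pts k y 0 = _
  simp [uninterpMap, secret_apply]

/-- The signed codeword of the polynomial with coefficients `c`. -/
def codeword (pts : EvalPoints q d) (k : SignKey d) (c : Fin (d + 1) → ZMod q) : Word q d :=
  fun i => sgn q k i * ∑ j, c j * pts.pt i ^ (j : ℕ)

theorem codeword_add (pts : EvalPoints q d) (k : SignKey d) (c c' : Fin (d + 1) → ZMod q) :
    codeword pts k (c + c') = codeword pts k c + codeword pts k c' := by
  funext i
  simp [codeword, add_mul, Finset.sum_add_distrib, mul_add]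

theorem codeword_sub (pts : EvalPoints q d) (k : SignKey d) (c c' : Fin (d + 1) → ZMod q) :
    codeword pts k (c - c') = codeword pts k c - codeword pts k c' := by
  rw [eq_sub_iff_add_eq, ← codeword_add, sub_add_cancel]

/-- The polynomial with coefficients `c`. -/
def coeffPoly (c : Fin (d + 1) → ZMod q) : Polynomial (ZMod q) :=
  ∑ j : Fin (d + 1), Polynomial.C (c j) * Polynomial.X ^ (j : ℕ)

theorem degree_coeffPoly_lt (c : Fin (d + 1) → ZMod q) :
    (coeffPoly c).degree < ((d + 1 : ℕ) : WithBot ℕ) := by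
  refine (Polynomial.degree_sum_le _ _).trans_lt ?_
  rw [Finset.sup_lt_iff (WithBot.bot_lt_coe _)]
  intro j _
  exact (Polynomial.degree_C_mul_X_pow_le _ _).trans_lt (by exact_mod_cast j.2)

theorem eval_coeffPoly (c : Fin (d + 1) → ZMod q) (x : ZMod q) :
    (coeffPoly c).eval x = ∑ j, c j * x ^ (j : ℕ) := by
  simp [coeffPoly, Polynomial.eval_finsetSum]

theorem eval_zero_coeffPoly (c : Fin (d + 1) → ZMod q) : (coeffPoly c).eval 0 = c 0 := by
  rw [eval_coeffPoly, Finset.sum_eq_single 0] <;> simp +contextual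

theorem card_headPos (d : ℕ) : (headPos d).card = d + 1 := by
  have : headPos d = (Finset.univ : Finset (Fin (d + 1))).map
      (Fin.castLEEmb (by omega : d + 1 ≤ 2 * d + 1)) := by
    ext i
    simp only [headPos, Finset.mem_filter, Finset.mem_univ, true_and, Finset.mem_map]
    constructor
    · intro h
      exact ⟨⟨i, by omega⟩, by ext; simp⟩
    · rintro ⟨j, rfl⟩
      simp; omega
  rw [this, Finset.card_map, Finset.card_univ, Fintype.card_fin]

theorem secret_codeword (pts : EvalPoints q d) (k : SignKey d) (c : Fin (d + 1) → ZMod q) :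
    secret pts k (codeword pts k c) = c 0 := by
  have : coeffPoly c = polyOfWord pts k (codeword pts k c) := by
    refine Lagrange.eq_interpolate_of_eval_eq _ pts.inj.injOn ?_ ?_
    · rw [card_headPos]; exact degree_coeffPoly_lt c
    · intro i _
      rw [eval_coeffPoly, codeword, ← mul_assoc, sgn_mul_self, one_mul]
  rw [secret_apply, ← this, eval_zero_coeffPoly]

theorem sgn_ne_zero (k : SignKey d) (i : Fin (2 * d + 1)) : sgn q k i ≠ 0 :=
  left_ne_zero_of_mul (b := sgn q k i) (by rw [sgn_mul_self]; exact one_ne_zero)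

theorem interpCoeff_ne_zero (pts : EvalPoints q d) (i : Fin (2 * d + 1)) :
    interpCoeff pts i ≠ 0 := by
  refine Finset.prod_ne_zero_iff.2 fun j hj => div_ne_zero (neg_ne_zero.2 (pts.ne_zero j)) ?_
  exact sub_ne_zero.2 fun h => (Finset.mem_erase.1 hj).1 (pts.inj h).symm

theorem secret_single_of_lt (pts : EvalPoints q d) (k : SignKey d) {i : Fin (2 * d + 1)}
    (hi : d < (i : ℕ)) : secret pts k (Pi.single i 1) = 0 := by
  rw [secret_apply, polyOfWord, Lagrange.interpolate_apply, Polynomial.eval_finsetSum]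
  refine Finset.sum_eq_zero fun j hj => ?_
  have hj' : (j : ℕ) ≤ d := by simpa [headPos] using hj
  have : j ≠ i := by rintro rfl; omega
  simp [Pi.single_eq_of_ne this]

theorem secret_single_zero_ne_zero (pts : EvalPoints q d) (k : SignKey d) :
    secret pts k (Pi.single 0 1) ≠ 0 := by
  rw [secret_apply, polyOfWord, Lagrange.interpolate_apply, Polynomial.eval_finsetSum,
    Finset.sum_eq_single_of_mem 0 (zero_mem_headPos d)]
  · rw [Polynomial.eval_mul, Lagrange.basis, Polynomial.eval_prod]
    refine mul_ne_zero (by simpa using sgn_ne_zero k 0) (Finset.prod_ne_zero_iff.2 fun j hj => ?_)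
    have hj0 : j ≠ 0 := (Finset.mem_erase.1 hj).1
    simp [Lagrange.basisDivisor, pts.ne_zero j, sub_eq_zero, pts.inj.eq_iff, hj0.symm]
  · intro j _ hj
    simp [hj]

/-- A codeword proportional to `c_i⁻¹ λ_i k_i`, where `λ_i k_i` are the coefficients of the
decoding functional, has non-zero logical value: its polynomial vanishes at the last `d`
evaluation points, so that a further zero at `0` would force it to vanish. -/
theorem ne_zero_of_codeword_eq (pts : EvalPoints q d) (k : SignKey d) {τ : ZMod q} (hτ : τ ≠ 0)
    (c : Fin (d + 1) → ZMod q)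
    (h : ∀ i, codeword pts k c i = τ * ((interpCoeff pts i)⁻¹ * secret pts k (Pi.single i 1))) :
    c 0 ≠ 0 := by
  intro h0
  have heval : ∀ i, codeword pts k c i = sgn q k i * (coeffPoly c).eval (pts.pt i) := fun i => by
    rw [eval_coeffPoly, codeword]
  have hcard : (insert 0 (headPos d)ᶜ : Finset (Fin (2 * d + 1))).card = d + 1 := by
    rw [Finset.card_insert_of_notMem (by simp [zero_mem_headPos]), Finset.card_compl, card_headPos,
      Fintype.card_fin]
    omega
  have hz : coeffPoly c = 0 := by
    refine Polynomial.eq_zero_of_degree_lt_of_eval_index_eq_zero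
      (s := insert 0 (headPos d)ᶜ) (v := zeroNodes pts) (zeroNodes_injective pts).injOn ?_ ?_
    · rw [hcard]; exact degree_coeffPoly_lt c
    · intro i hi
      by_cases hi0 : i = 0
      · rw [hi0, zeroNodes_zero, eval_zero_coeffPoly, h0]
      · have hd : d < (i : ℕ) := by simpa [hi0, headPos] using hi
        have := (heval i).symm.trans (h i)
        rw [secret_single_of_lt pts k hd, mul_zero, mul_zero] at this
        rw [zeroNodes_of_ne pts hi0]
        exact (mul_eq_zero.1 this).resolve_left (sgn_ne_zero k i)
  have := (heval 0).symm.trans (h 0)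
  rw [hz, Polynomial.eval_zero, mul_zero] at this
  exact mul_ne_zero hτ (mul_ne_zero (inv_ne_zero (interpCoeff_ne_zero pts 0))
    (secret_single_zero_ne_zero pts k)) this.symm

theorem codeState_apply (pts : EvalPoints q d) (k : SignKey d) (a : ZMod q) (w : Word q d) :
    codeState pts k a w = ((Real.sqrt ((q : ℝ) ^ d) : ℝ) : ℂ)⁻¹ *
      ∑ c : Fin (d + 1) → ZMod q, if c 0 = a ∧ codeword pts k c = w then 1 else 0 := by
  rw [codeState, Pi.smul_apply, Finset.sum_apply, smul_eq_mul]
  congr 1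
  refine Finset.sum_congr rfl fun c _ => ?_
  change (if c 0 = a then (Pi.single (codeword pts k c) 1 : Word q d → ℂ) else 0) w = _
  by_cases h : c 0 = a <;> simp [h, Pi.single_apply, eq_comm]

theorem exists_codeword_of_codeState_ne_zero {pts : EvalPoints q d} {k : SignKey d} {a : ZMod q}
    {w : Word q d} (h : codeState pts k a w ≠ 0) : ∃ c, c 0 = a ∧ codeword pts k c = w := by
  by_contra! hc
  refine h ?_
  rw [codeState_apply, Finset.sum_eq_zero, mul_zero]
  intro c _
  exact if_neg fun hh => hc c hh.1 hh.2

theorem secret_of_codeState_ne_zero {pts : EvalPoints q d} {k : SignKey d} {a : ZMod q}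
    {w : Word q d} (h : codeState pts k a w ≠ 0) : secret pts k w = a := by
  obtain ⟨c, rfl, rfl⟩ := exists_codeword_of_codeState_ne_zero h
  exact secret_codeword pts k c

theorem codeState_add (pts : EvalPoints q d) (k : SignKey d) (a : ZMod q)
    (c₀ : Fin (d + 1) → ZMod q) (w : Word q d) :
    codeState pts k (a + c₀ 0) (w + codeword pts k c₀) = codeState pts k a w := by
  rw [codeState_apply, codeState_apply, ← Equiv.sum_comp (Equiv.addRight c₀)]
  simp [codeword_add]

/-- The common squared norm of the code states. -/
def codeNormSq (pts : EvalPoints q d) (k : SignKey d) : ℂ :=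
  ∑ w, codeState pts k 0 w * star (codeState pts k 0 w)

theorem sum_codeState_mul_star (pts : EvalPoints q d) (k : SignKey d) (a : ZMod q) :
    ∑ w, codeState pts k a w * star (codeState pts k a w) = codeNormSq pts k := by
  rw [codeNormSq, ← Equiv.sum_comp (Equiv.addRight (codeword pts k (Pi.single 0 a)))]
  refine Finset.sum_congr rfl fun w _ => ?_
  have := codeState_add pts k 0 (Pi.single 0 a) w
  rw [Pi.single_eq_same, zero_add] at this
  rw [Equiv.coe_addRight, this]

/-- The matrix element `⟨S_{a'}| X^A Z^{-B} |S_a⟩` of a Pauli operator on one block between code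
states. -/
def overlap (pts : EvalPoints q d) (k : SignKey d) (B A : Word q d) (a a' : ZMod q) : ℂ :=
  ∑ w, ZMod.stdAddChar (-∑ i, B i * w i) *
    (codeState pts k a w * star (codeState pts k a' (w + A)))

theorem sum_mul_secret_single (pts : EvalPoints q d) (k : SignKey d) (w : Word q d) :
    ∑ i, secret pts k (Pi.single i 1) * w i = secret pts k w := by
  conv_rhs => rw [LinearMap.pi_apply_eq_sum_univ (secret pts k) w]
  refine Finset.sum_congr rfl fun i _ => ?_
  rw [smul_eq_mul, mul_comm]
  congr 2
  funext j
  simp [Pi.single_apply, eq_comm]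

/-- `Z`-type operators along the decoding functional act on the code states as logical phases. -/
theorem overlap_phase (pts : EvalPoints q d) (k : SignKey d) {τ : ZMod q} {B : Word q d}
    (hB : ∀ i, B i = -(τ * secret pts k (Pi.single i 1))) (a a' : ZMod q) :
    overlap pts k B 0 a a' =
      if a = a' then ZMod.stdAddChar (τ * a) * codeNormSq pts k else 0 := by
  have hsum : ∀ w : Word q d, -∑ i, B i * w i = τ * secret pts k w := fun w => by
    simp_rw [hB, neg_mul, Finset.sum_neg_distrib, neg_neg, mul_assoc, ← Finset.mul_sum,
      sum_mul_secret_single]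
  simp only [overlap, add_zero, hsum]
  split_ifs with h
  · subst h
    rw [← sum_codeState_mul_star pts k a, Finset.mul_sum]
    refine Finset.sum_congr rfl fun w _ => ?_
    by_cases hw : codeState pts k a w = 0
    · simp [hw]
    · rw [secret_of_codeState_ne_zero hw]
  · refine Finset.sum_eq_zero fun w _ => ?_
    by_cases hw : codeState pts k a w = 0
    · simp [hw]
    by_cases hw' : codeState pts k a' w = 0
    · simp [hw']
    · exact absurd ((secret_of_codeState_ne_zero hw).symm.trans (secret_of_codeState_ne_zero hw')) h

theorem overlap_zero (pts : EvalPoints q d) (k : SignKey d) (a a' : ZMod q) :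
    overlap pts k 0 0 a a' = if a = a' then codeNormSq pts k else 0 := by
  rw [overlap_phase pts k (τ := 0) (by simp)]
  simp

/-- A non-trivial shift along the Fourier-transformed decoding functional has no diagonal matrix
elements between code states: it either leaves the code or changes the logical value. -/
theorem overlap_shift_self (pts : EvalPoints q d) (k : SignKey d) {τ : ZMod q} (hτ : τ ≠ 0)
    {A : Word q d}
    (hA : ∀ i, A i = -(τ * ((interpCoeff pts i)⁻¹ * secret pts k (Pi.single i 1))))
    (B : Word q d) (a : ZMod q) : overlap pts k B A a a = 0 := by
  refine Finset.sum_eq_zero fun w _ => ?_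
  by_cases hw : codeState pts k a w = 0
  · simp [hw]
  by_cases hw' : codeState pts k a (w + A) = 0
  · simp [hw']
  obtain ⟨c, hc, rfl⟩ := exists_codeword_of_codeState_ne_zero hw
  obtain ⟨c', hc', hcA⟩ := exists_codeword_of_codeState_ne_zero hw'
  refine absurd ?_ (ne_zero_of_codeword_eq pts k hτ (c - c') fun i => ?_)
  · simp [hc, hc']
  · rw [codeword_sub, hcA, Pi.sub_apply, Pi.add_apply, sub_add_cancel_left, hA, neg_neg]

end CodeLemmas

/-! ### Pauli twirls of the authenticated state -/

section Characters

variable {q : ℕ} [Fact q.Prime]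

theorem star_stdAddChar (a : ZMod q) :
    star (ZMod.stdAddChar a : ℂ) = ZMod.stdAddChar (-a) :=
  (AddChar.map_neg_eq_conj _ _).symm

theorem stdAddChar_sum {ι : Type*} (s : Finset ι) (f : ι → ZMod q) :
    (ZMod.stdAddChar (∑ i ∈ s, f i) : ℂ) = ∏ i ∈ s, ZMod.stdAddChar (f i) := by
  classical
  induction s using Finset.induction_on with
  | empty => simp
  | insert a s ha ih => rw [Finset.sum_insert ha, Finset.prod_insert ha, AddChar.map_add_eq_mul, ih]

theorem sum_stdAddChar_linearMap_eq_zero {M : Type*} [AddCommGroup M] [Fintype M]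
    [Module (ZMod q) M] {f : M →ₗ[ZMod q] ZMod q} (hf : f ≠ 0) :
    ∑ x, (ZMod.stdAddChar (f x) : ℂ) = 0 := by
  obtain ⟨x, hx⟩ : ∃ x, f x ≠ 0 := by
    by_contra! h
    exact hf (LinearMap.ext h)
  refine AddChar.sum_eq_zero_of_ne_one
    (ψ := (ZMod.stdAddChar (N := q)).compAddMonoidHom f.toAddMonoidHom) fun h => hx ?_
  refine ZMod.injective_stdAddChar ?_
  rw [AddChar.map_zero_eq_one]
  exact DFunLike.congr_fun h x

theorem ite_eq_sum_stdAddChar {ι : Type*} [Fintype ι] [DecidableEq ι] (u v : ι → ZMod q) :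
    (if u = v then 1 else 0 : ℂ) = (Fintype.card (ι → ZMod q) : ℂ)⁻¹ *
      ∑ τ : ι → ZMod q, ZMod.stdAddChar (∑ j, τ j * (u j - v j)) := by
  split_ifs with h
  · subst h
    have : (Fintype.card (ι → ZMod q) : ℂ) ≠ 0 := by exact_mod_cast Fintype.card_ne_zero
    simp only [sub_self, mul_zero, Finset.sum_const_zero, AddChar.map_zero_eq_one,
      Finset.sum_const, Finset.card_univ, nsmul_eq_mul, mul_one]
    rw [inv_mul_cancel₀ this]
  · obtain ⟨j, hj⟩ := Function.ne_iff.1 h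
    have := sum_stdAddChar_linearMap_eq_zero
      (f := ∑ j, (u j - v j) • (LinearMap.proj j : (ι → ZMod q) →ₗ[ZMod q] ZMod q)) (by
        intro h0
        have := LinearMap.congr_fun h0 (Pi.single j 1)
        simp [Pi.single_apply, sub_eq_zero, hj] at this)
    simp only [LinearMap.sum_apply, LinearMap.smul_apply, LinearMap.proj_apply, smul_eq_mul,
      mul_comm (_ - _)] at this
    rw [this, mul_zero]

/-- A product of logical `Z`-phases on the first two qudits of a Toffoli state and a logical shift
of the third has expectation zero, unless it is trivial. The operators are given by their matrix
elements `M j` between code states, `N` being the squared norm of a code state. -/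
theorem sum_toffoliState_eq_zero {τ : Fin 3 → ZMod q} (hτ : τ ≠ 0) (N : ℂ)
    (M : Fin 3 → ZMod q → ZMod q → ℂ)
    (h0 : ∀ a a', M 0 a a' = if a = a' then ZMod.stdAddChar (τ 0 * a) * N else 0)
    (h1 : ∀ a a', M 1 a a' = if a = a' then ZMod.stdAddChar (τ 1 * a) * N else 0)
    (h2 : τ 2 ≠ 0 → ∀ a, M 2 a a = 0)
    (h2' : τ 2 = 0 → ∀ a a', M 2 a a' = if a = a' then N else 0) :
    ∑ v, ∑ v', toffoliState q v * star (toffoliState q v') * ∏ j, M j (v j) (v' j) = 0 := by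
  by_cases ht : τ 2 = 0
  · have key : ∀ v : Fin 3 → ZMod q,
        ∑ v', toffoliState q v * star (toffoliState q v') * ∏ j, M j (v j) (v' j) =
        if v 2 = v 0 * v 1 then
          (q : ℂ)⁻¹ * star (q : ℂ)⁻¹ * N ^ 3 * ZMod.stdAddChar (τ 0 * v 0 + τ 1 * v 1) else 0 := by
      intro v
      rw [Finset.sum_eq_single v]
      · rw [Fin.prod_univ_three, h0, h1, h2' ht, if_pos rfl, if_pos rfl, if_pos rfl, toffoliState,
          AddChar.map_add_eq_mul]
        split_ifs
        · ring
        · simp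
      · intro v' _ hv
        obtain ⟨j, hj⟩ := Function.ne_iff.1 hv
        rw [Finset.prod_eq_zero (Finset.mem_univ j), mul_zero]
        fin_cases j
        · exact (h0 _ _).trans (if_neg (Ne.symm hj))
        · exact (h1 _ _).trans (if_neg (Ne.symm hj))
        · exact (h2' ht _ _).trans (if_neg (Ne.symm hj))
      · simp
    simp_rw [key]
    rw [← Finset.sum_filter, ← Finset.mul_sum]
    have hbij : ∑ v : Fin 3 → ZMod q with v 2 = v 0 * v 1,
        (ZMod.stdAddChar (τ 0 * v 0 + τ 1 * v 1) : ℂ) =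
        ∑ x : ZMod q × ZMod q, ZMod.stdAddChar (τ 0 * x.1 + τ 1 * x.2) := by
      refine Finset.sum_bij' (fun v _ => (v 0, v 1)) (fun x _ => ![x.1, x.2, x.1 * x.2])
        (fun _ _ => Finset.mem_univ _) (by simp) ?_ (by simp) (by simp)
      intro v hv
      have hv' : v 2 = v 0 * v 1 := by simpa using hv
      funext j
      fin_cases j <;> simp [hv']
    rw [hbij]
    have := sum_stdAddChar_linearMap_eq_zero (f := τ 0 • LinearMap.fst (ZMod q) (ZMod q) (ZMod q) +
      τ 1 • LinearMap.snd (ZMod q) (ZMod q) (ZMod q)) (by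
        intro h
        have e0 := LinearMap.congr_fun h (1, 0)
        have e1 := LinearMap.congr_fun h (0, 1)
        simp at e0 e1
        refine hτ (funext fun j => ?_)
        fin_cases j <;> simp [e0, e1, ht])
    simp only [LinearMap.add_apply, LinearMap.smul_apply, LinearMap.fst_apply,
      LinearMap.snd_apply, smul_eq_mul] at this
    rw [this, mul_zero]
  · refine Finset.sum_eq_zero fun v _ => Finset.sum_eq_zero fun v' _ => ?_
    rw [Fin.prod_univ_three, h0, h1]
    by_cases e0 : v 0 = v' 0
    · by_cases e1 : v 1 = v' 1
      · by_cases e2 : v 2 = v' 2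
        · rw [e2, h2 ht]; simp
        · have : toffoliState q v = 0 ∨ toffoliState q v' = 0 := by
            by_contra! hne
            simp only [toffoliState, ne_eq, ite_eq_right_iff, Classical.not_imp] at hne
            exact e2 (by rw [hne.1.1, hne.2.1, e0, e1])
          rcases this with h | h <;> simp [h]
      · simp [e1]
    · simp [e0]

end Characters

section Twirl

variable {q n L d : ℕ} [Fact q.Prime]

/-- The standard bilinear form on strings over all qudits. -/
def regDot (u v : Reg q n L d) : ZMod q := ∑ b, ∑ i, u b i * v b i

theorem regDot_add_right (u v w : Reg q n L d) : regDot u (v + w) = regDot u v + regDot u w := by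
  simp [regDot, mul_add, Finset.sum_add_distrib]

theorem regDot_sub_right (u v w : Reg q n L d) : regDot u (v - w) = regDot u v - regDot u w := by
  simp [regDot, mul_sub, Finset.sum_sub_distrib]

theorem regDot_comm (u v : Reg q n L d) : regDot u v = regDot v u := by
  simp [regDot, mul_comm]

theorem sum_stdAddChar_regDot_eq_zero {v : Reg q n L d} (hv : v ≠ 0) :
    ∑ z, (ZMod.stdAddChar (regDot z v) : ℂ) = 0 := by
  obtain ⟨b, hb⟩ := Function.ne_iff.1 hv
  obtain ⟨i, hi⟩ := Function.ne_iff.1 hb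
  refine sum_stdAddChar_linearMap_eq_zero (q := q)
    (f := { toFun := fun z => regDot z v
            map_add' := fun x y => by simp only [regDot_comm _ v, regDot_add_right]
            map_smul' := fun r x => by
              simp only [regDot, Pi.smul_apply, smul_eq_mul, Finset.mul_sum, mul_assoc,
                RingHom.id_apply] }) fun h => hi ?_
  have := LinearMap.congr_fun h (Pi.single b (Pi.single i 1))
  simp only [LinearMap.coe_mk, AddHom.coe_mk, LinearMap.zero_apply, regDot] at this
  rw [Finset.sum_eq_single b, Finset.sum_eq_single i] at this
  · simpa using this
  · intro j _ hj; simp [hj]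
  · simp
  · intro b' _ hb'; simp [hb']
  · simp

theorem pauli_conj_apply (p : PauliKey q n L d) (R : Matrix (Reg q n L d) (Reg q n L d) ℂ)
    (y' y : Reg q n L d) :
    (pauli p * R * (pauli p).conjTranspose) y' y =
      ZMod.stdAddChar (regDot p.2 (y' - y)) * R (y' - p.1) (y - p.1) := by
  rw [Matrix.mul_apply, Finset.sum_eq_single (y - p.1), Matrix.mul_apply,
    Finset.sum_eq_single (y' - p.1)]
  · rw [Matrix.conjTranspose_apply, pauli, Matrix.of_apply, Matrix.of_apply,
      if_pos (sub_add_cancel _ _).symm, if_pos (sub_add_cancel _ _).symm, star_stdAddChar,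
      regDot_sub_right, sub_eq_add_neg (regDot _ _), AddChar.map_add_eq_mul]
    simp only [regDot]
    ring
  · intro v _ hv
    rw [pauli, Matrix.of_apply, if_neg fun h => hv (eq_sub_of_add_eq h.symm), zero_mul]
  · simp
  · intro v _ hv
    rw [Matrix.conjTranspose_apply, pauli, Matrix.of_apply,
      if_neg fun h => hv (eq_sub_of_add_eq h.symm), star_zero, mul_zero]
  · simp

/-- The expectation of the Pauli operator `X^A Z^{-B}` in the encoded state. -/
def encodedExpectation (pts : EvalPoints q d) (k : SignKey d)
    (ρ : Matrix (Fin n → ZMod q) (Fin n → ZMod q) ℂ) (B A : Reg q n L d) : ℂ :=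
  ∑ w, ZMod.stdAddChar (-regDot B w) * encodedState pts k ρ w (w + A)

/-- A twirl with a character is determined by the expectation of the dual Pauli operator: the sum
over the `Z`-keys leaves only the entries with `y - y' = A`, and the sum over the `X`-keys gives the
expectation. -/
theorem sum_authenticated_apply (pts : EvalPoints q d) (k : SignKey d)
    (ρ : Matrix (Fin n → ZMod q) (Fin n → ZMod q) ℂ) (B A : Reg q n L d) (y' y : Reg q n L d) :
    (∑ p : PauliKey q n L d, (ZMod.stdAddChar (regDot B p.1 + regDot A p.2) : ℂ) •
        authenticated pts (k, p) ρ) y' y =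
      (∑ z, (ZMod.stdAddChar (regDot z (A + (y' - y))) : ℂ)) *
        (ZMod.stdAddChar (regDot B y') * encodedExpectation pts k ρ B A) := by
  rw [Matrix.sum_apply, Fintype.sum_prod_type, Finset.sum_comm, Finset.sum_mul]
  refine (Finset.sum_congr rfl fun z _ => ?_ : _ = ∑ z, (ZMod.stdAddChar (regDot z (A + (y' - y)))
    * (ZMod.stdAddChar (regDot B y') * ∑ w, ZMod.stdAddChar (-regDot B w) *
      encodedState pts k ρ w (w + (y - y'))))).trans ?_
  · rw [← Equiv.sum_comp (Equiv.subLeft y'), Finset.mul_sum, Finset.mul_sum]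
    refine Finset.sum_congr rfl fun w _ => ?_
    rw [Matrix.smul_apply, authenticated, pauli_conj_apply, smul_eq_mul]
    have e1 : y' - (Equiv.subLeft y') w = w := by simp
    have e2 : y - (Equiv.subLeft y') w = w + (y - y') := by
      rw [Equiv.subLeft_apply]; abel
    simp only [e1, e2]
    rw [Equiv.subLeft_apply, regDot_sub_right, regDot_add_right, regDot_comm A z, sub_eq_add_neg]
    simp only [AddChar.map_add_eq_mul]
    ring
  · rw [← Finset.sum_mul, ← Finset.sum_mul]
    by_cases h : A + (y' - y) = 0
    · have : y - y' = A := by rw [← neg_sub, ← eq_neg_of_add_eq_zero_left h]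
      rw [this, encodedExpectation]
    · rw [sum_stdAddChar_regDot_eq_zero h, zero_mul, zero_mul]

theorem encodedExpectation_eq (pts : EvalPoints q d) (k : SignKey d)
    (ρ : Matrix (Fin n → ZMod q) (Fin n → ZMod q) ℂ) (B A : Reg q n L d) :
    encodedExpectation pts k ρ B A =
      ∑ a, ∑ a', logicalState L ρ a a' * ∏ b, overlap pts k (B b) (A b) (a b) (a' b) := by
  have h1 : ∀ w : Reg q n L d, (ZMod.stdAddChar (-regDot B w) : ℂ) =
      ∏ b, ZMod.stdAddChar (-∑ i, B b i * w b i) := fun w => by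
    rw [regDot, ← Finset.sum_neg_distrib, stdAddChar_sum]
  have h2 : ∀ w w' : Reg q n L d, encodedState pts k ρ w w' =
      ∑ a, ∑ a', logicalState L ρ a a' *
        ∏ b, codeState pts k (a b) (w b) * star (codeState pts k (a' b) (w' b)) := by
    intro w w'
    simp only [encodedState, Matrix.mul_apply, Finset.sum_mul]
    rw [Finset.sum_comm]
    refine Finset.sum_congr rfl fun a _ => Finset.sum_congr rfl fun a' _ => ?_
    rw [Matrix.conjTranspose_apply, encode, Matrix.of_apply, Matrix.of_apply,
      Finset.prod_mul_distrib, star_prod]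
    ring
  simp only [encodedExpectation, h2, Finset.mul_sum]
  rw [Finset.sum_comm]
  refine Finset.sum_congr rfl fun a _ => ?_
  rw [Finset.sum_comm]
  refine Finset.sum_congr rfl fun a' _ => ?_
  simp only [overlap]
  rw [Fintype.prod_sum, Finset.mul_sum]
  refine Finset.sum_congr rfl fun w _ => ?_
  rw [h1, mul_left_comm, ← Finset.prod_mul_distrib]
  rfl

/-- Splitting of the labels of all blocks into those of the input and of the Toffoli states. -/
def blockEquiv (q n L : ℕ) :
    (Block n L → ZMod q) ≃ (Fin n → ZMod q) × (Fin L → Fin 3 → ZMod q) :=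
  (Equiv.sumArrowEquivProdArrow _ _ _).trans (Equiv.prodCongr (Equiv.refl _) (Equiv.curry _ _ _))

/-- The expectation of a product operator in the logical state factors over the input and the
Toffoli states. -/
theorem sum_logicalState_mul_prod (ρ : Matrix (Fin n → ZMod q) (Fin n → ZMod q) ℂ)
    (M : Block n L → ZMod q → ZMod q → ℂ) :
    ∑ a, ∑ a', logicalState L ρ a a' * ∏ b, M b (a b) (a' b) =
      (∑ u, ∑ u', ρ u u' * ∏ w, M (Sum.inl w) (u w) (u' w)) *
        ∏ t : Fin L, ∑ v, ∑ v', toffoliState q v * star (toffoliState q v') *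
          ∏ j, M (Sum.inr (t, j)) (v j) (v' j) := by
  rw [Fintype.prod_sum]
  simp_rw [Fintype.prod_sum]
  rw [← Equiv.sum_comp (blockEquiv q n L).symm, Fintype.sum_prod_type, Finset.sum_mul]
  refine Finset.sum_congr rfl fun u _ => ?_
  rw [Finset.mul_sum]
  refine Finset.sum_congr rfl fun v _ => ?_
  rw [← Equiv.sum_comp (blockEquiv q n L).symm, Fintype.sum_prod_type, Finset.sum_mul]
  refine Finset.sum_congr rfl fun u' _ => ?_
  rw [Finset.mul_sum]
  refine Finset.sum_congr rfl fun v' _ => ?_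
  rw [logicalState, Matrix.of_apply, Fintype.prod_sum_type, Fintype.prod_prod_type,
    Finset.prod_mul_distrib (f := fun t => toffoliState q (v t) * star (toffoliState q (v' t)))]
  change ρ u u' * (∏ t, toffoliState q (v t) * star (toffoliState q (v' t))) *
    ((∏ w, M (Sum.inl w) (u w) (u' w)) * ∏ t, ∏ j, M (Sum.inr (t, j)) (v t j) (v' t j)) = _
  ring

/-- Pauli keys that vanish outside the three blocks of the `t`-th Toffoli state. -/
def SupportedAt (t : ℕ) (p : PauliKey q n L d) : Prop :=
  ∀ b : Block n L, (∀ (ht : t < L) (j : Fin 3), b ≠ Sum.inr (⟨t, ht⟩, j)) → p.1 b = 0 ∧ p.2 b = 0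

/-- A linear functional of the Pauli keys detects the `t`-th Toffoli state if its restriction to
the keys of that state is a combination, with coefficients not all zero, of the three functionals
through which the answers of that round depend on those keys. -/
def Detects (pts : EvalPoints q d) (k : SignKey d) (f : PauliKey q n L d →ₗ[ZMod q] ZMod q)
    (t : Fin L) : Prop :=
  ∃ τ : Fin 3 → ZMod q, τ ≠ 0 ∧ ∀ p, SupportedAt (t : ℕ) p →
    f p = -(τ 0 * secret pts k (p.1 (Sum.inr (t, 0))) + τ 1 * secret pts k (p.1 (Sum.inr (t, 1))) +
      τ 2 * secret pts k (fun i => (interpCoeff pts i)⁻¹ * p.2 (Sum.inr (t, 2)) i))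

theorem linearMap_pauliKey_apply (f : PauliKey q n L d →ₗ[ZMod q] ZMod q) (p : PauliKey q n L d) :
    f p = regDot (fun b i => f (Pi.single b (Pi.single i 1), 0)) p.1 +
      regDot (fun b i => f (0, Pi.single b (Pi.single i 1))) p.2 := by
  have hp : ∀ x : Reg q n L d, x = ∑ b, ∑ i, x b i • Pi.single b (Pi.single i 1) := by
    intro x
    funext b i
    simp only [Finset.sum_apply, Pi.smul_apply, smul_eq_mul]
    rw [Finset.sum_eq_single b, Finset.sum_eq_single i]
    · simp
    · intro j _ hj; simp [hj.symm]
    · simp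
    · intro b' _ hb'; simp [hb'.symm]
    · simp
  have h1 : f (p.1, 0) = regDot (fun b i => f (Pi.single b (Pi.single i 1), 0)) p.1 := by
    change (f ∘ₗ LinearMap.inl _ _ _) p.1 = _
    conv_lhs => rw [hp p.1]
    simp only [map_sum, map_smul, regDot, LinearMap.comp_apply, LinearMap.inl_apply, smul_eq_mul,
      mul_comm]
  have h2 : f (0, p.2) = regDot (fun b i => f (0, Pi.single b (Pi.single i 1))) p.2 := by
    change (f ∘ₗ LinearMap.inr _ _ _) p.2 = _
    conv_lhs => rw [hp p.2]
    simp only [map_sum, map_smul, regDot, LinearMap.comp_apply, LinearMap.inr_apply, smul_eq_mul,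
      mul_comm]
  rw [← h1, ← h2, ← map_add]
  simp

theorem supportedAt_single_fst (t : Fin L) (j : Fin 3) (i : Fin (2 * d + 1)) :
    SupportedAt (t : ℕ)
      ((Pi.single (Sum.inr (t, j)) (Pi.single i 1), 0) : PauliKey q n L d) := by
  intro b hb
  have := hb t.2 j
  simp [Pi.single_eq_of_ne this]

theorem supportedAt_single_snd (t : Fin L) (j : Fin 3) (i : Fin (2 * d + 1)) :
    SupportedAt (t : ℕ)
      ((0, Pi.single (Sum.inr (t, j)) (Pi.single i 1)) : PauliKey q n L d) := by
  intro b hb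
  have := hb t.2 j
  simp [Pi.single_eq_of_ne this]

/-- The Pauli operator dual to a functional that detects a Toffoli state has expectation zero. -/
theorem encodedExpectation_eq_zero {pts : EvalPoints q d} {k : SignKey d}
    {f : PauliKey q n L d →ₗ[ZMod q] ZMod q} {t : Fin L} (hf : Detects pts k f t)
    (ρ : Matrix (Fin n → ZMod q) (Fin n → ZMod q) ℂ) :
    encodedExpectation pts k ρ (fun b i => f (Pi.single b (Pi.single i 1), 0))
      (fun b i => f (0, Pi.single b (Pi.single i 1))) = 0 := by
  obtain ⟨τ, hτ, hf⟩ := hf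
  rw [encodedExpectation_eq, sum_logicalState_mul_prod]
  refine mul_eq_zero_of_right _ (Finset.prod_eq_zero (Finset.mem_univ t) ?_)
  have hx : ∀ j i, f (Pi.single (Sum.inr (t, j)) (Pi.single i 1), 0) =
      if j = 2 then 0 else -(τ j * secret pts k (Pi.single i 1)) := by
    intro j i
    rw [hf _ (supportedAt_single_fst t j i)]
    have h0 : (fun _ => 0 : Word q d) = 0 := rfl
    fin_cases j <;> simp [h0]
  have hz : ∀ j i, f (0, Pi.single (Sum.inr (t, j)) (Pi.single i 1)) =
      if j = 2 then -(τ 2 * ((interpCoeff pts i)⁻¹ * secret pts k (Pi.single i 1))) else 0 := by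
    intro j i
    rw [hf _ (supportedAt_single_snd t j i)]
    have h0 : (fun _ => 0 : Word q d) = 0 := rfl
    have h1 : (fun i' => (interpCoeff pts i')⁻¹ * (Pi.single i 1 : Word q d) i') =
        (interpCoeff pts i)⁻¹ • Pi.single i 1 := by
      funext i'
      by_cases h : i' = i
      · subst h; simp
      · simp [h]
    fin_cases j
    · simp [h0]
    · simp [h0]
    · simp [h1]
  refine sum_toffoliState_eq_zero hτ (codeNormSq pts k) _ ?_ ?_ ?_ ?_
  · intro a a'
    have : (fun i => f (0, Pi.single (Sum.inr (t, 0)) (Pi.single i 1))) = (0 : Word q d) := by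
      funext i; simp [hz]
    rw [this]
    exact overlap_phase pts k (fun i => by simp [hx]) a a'
  · intro a a'
    have : (fun i => f (0, Pi.single (Sum.inr (t, 1)) (Pi.single i 1))) = (0 : Word q d) := by
      funext i; simp [hz]
    rw [this]
    exact overlap_phase pts k (fun i => by simp [hx]) a a'
  · intro h a
    exact overlap_shift_self pts k h (fun i => by simp [hz]) _ a
  · intro h a a'
    have e1 : (fun i => f (0, Pi.single (Sum.inr (t, 2)) (Pi.single i 1))) = (0 : Word q d) := by
      funext i; simp [hz, h]
    have e2 : (fun i => f (Pi.single (Sum.inr (t, 2)) (Pi.single i 1), 0)) = (0 : Word q d) := by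
      funext i; simp [hx]
    rw [e1, e2, overlap_zero]

theorem encodedExpectation_zero_zero (pts : EvalPoints q d) (k : SignKey d)
    (ρ : Matrix (Fin n → ZMod q) (Fin n → ZMod q) ℂ) :
    encodedExpectation (L := L) pts k ρ 0 0 = ρ.trace * (codeNormSq pts k ^ n *
      ∏ _t : Fin L, ∑ v, ∑ v', toffoliState q v * star (toffoliState q v') *
        ∏ j, if v j = v' j then codeNormSq pts k else 0) := by
  rw [encodedExpectation_eq]
  simp only [Pi.zero_apply, overlap_zero]
  rw [sum_logicalState_mul_prod ρ fun _ a a' => if a = a' then codeNormSq pts k else 0, ← mul_assoc]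
  congr 1
  rw [Matrix.trace, Finset.sum_mul]
  refine Finset.sum_congr rfl fun u _ => ?_
  rw [Finset.sum_eq_single u]
  · simp
  · intro u' _ hu
    obtain ⟨w, hw⟩ := Function.ne_iff.1 hu
    rw [Finset.prod_eq_zero (Finset.mem_univ w) (if_neg (Ne.symm hw)), mul_zero]
  · simp

/-- A character twirl over the Pauli keys hides the input if the character is trivial or detects
a Toffoli state. -/
theorem sum_authenticated_eq {pts : EvalPoints q d} {k : SignKey d}
    {f : PauliKey q n L d →ₗ[ZMod q] ZMod q} (hf : f = 0 ∨ ∃ t, Detects pts k f t)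
    {ρ ρ' : Matrix (Fin n → ZMod q) (Fin n → ZMod q) ℂ} (h : ρ.trace = ρ'.trace) :
    ∑ p, (ZMod.stdAddChar (f p) : ℂ) • authenticated pts (k, p) ρ =
      ∑ p, (ZMod.stdAddChar (f p) : ℂ) • authenticated pts (k, p) ρ' := by
  obtain ⟨B, hB⟩ : ∃ B : Reg q n L d, B = fun b i => f (Pi.single b (Pi.single i 1), 0) := ⟨_, rfl⟩
  obtain ⟨A, hA⟩ : ∃ A : Reg q n L d, A = fun b i => f (0, Pi.single b (Pi.single i 1)) := ⟨_, rfl⟩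
  have hBA : ∀ p, f p = regDot B p.1 + regDot A p.2 := fun p => by
    rw [linearMap_pauliKey_apply f p, hB, hA]
  have key : encodedExpectation pts k ρ B A = encodedExpectation pts k ρ' B A := by
    rcases hf with hf | ⟨t, hf⟩
    · have hB0 : B = 0 := by rw [hB, hf]; rfl
      have hA0 : A = 0 := by rw [hA, hf]; rfl
      rw [hB0, hA0, encodedExpectation_zero_zero, encodedExpectation_zero_zero, h]
    · rw [hB, hA, encodedExpectation_eq_zero hf, encodedExpectation_eq_zero hf]
  ext y' y
  simp only [hBA]
  rw [sum_authenticated_apply, sum_authenticated_apply, key]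

end Twirl

/-! ### The keys of the verifier as affine functions of the initial Pauli keys -/

/-- All qudits on which a gate acts satisfy `P`. -/
def CliffordGate.ActsWithin {q : ℕ} {ι : Type} (P : ι → Prop) : CliffordGate q ι → Prop
  | .pauliX _ i => P i
  | .pauliZ _ i => P i
  | .fourier i => P i
  | .fourierInv i => P i
  | .sum _ i j => P i ∧ P j

theorem CliffordGate.actsWithin_map {q : ℕ} {ι κ : Type} {P : κ → Prop} {f : ι → κ}
    (h : ∀ i, P (f i)) (g : CliffordGate q ι) : (g.map f).ActsWithin P := by
  cases g <;> simp [CliffordGate.map, CliffordGate.ActsWithin, h]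

section Locations

variable {q n L : ℕ}

/-- The blocks that are in use after `i` rounds: those of the input and of the first `i` Toffoli
states. -/
def InUse (i : ℕ) : Block n L → Prop
  | Sum.inl _ => True
  | Sum.inr p => (p.1 : ℕ) < i

theorem InUse.mono {i i' : ℕ} (h : i ≤ i') {b : Block n L} (hb : InUse i b) : InUse i' b := by
  cases b with
  | inl w => trivial
  | inr p => exact lt_of_lt_of_le (show (p.1 : ℕ) < i from hb) h

theorem inUse_loc (C : Circuit q n L) (i : ℕ) (hi : i ≤ L) (w : Fin n) :
    InUse i (loc C i hi w) := by
  induction i with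
  | zero => trivial
  | succ i ih =>
    rw [loc]
    split_ifs
    · exact Nat.lt_succ_self i
    · exact Nat.lt_succ_self i
    · exact Nat.lt_succ_self i
    · exact (ih _).mono (Nat.le_succ i)

theorem ne_of_inUse {i : ℕ} {b : Block n L} (hb : InUse i b) {t : Fin L} (ht : i ≤ t)
    (j : Fin 3) : b ≠ Sum.inr (t, j) := by
  rintro rfl
  exact absurd (show (t : ℕ) < i from hb) (by omega)

theorem loc_injective (C : Circuit q n L) (i : ℕ) (hi : i ≤ L) :
    Function.Injective (loc C i hi) := by
  induction i with
  | zero => exact Sum.inl_injective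
  | succ i ih =>
    intro w w' h
    have hne : ∀ w j, loc C i (Nat.le_of_succ_le hi) w ≠ Sum.inr (⟨i, hi⟩, j) := fun w j =>
      ne_of_inUse (inUse_loc C i _ w) le_rfl j
    simp only [loc] at h
    split_ifs at h <;> simp_all [(hne _ _).symm, (ih _).eq_iff]

theorem inUse_measuredBlock (C : Circuit q n L) (i : ℕ) (hi : i < L) (j : Fin 3) :
    InUse i (measuredBlock C i hi j) := inUse_loc C i _ _

theorem measuredBlock_injective (C : Circuit q n L) (i : ℕ) (hi : i < L) :
    Function.Injective (measuredBlock C i hi) :=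
  (loc_injective C i hi.le).comp (C.toffoli ⟨i, hi⟩).injective

theorem actsWithin_of_mem_cliffordGates (C : Circuit q n L) (i : ℕ) (hi : i ≤ L) :
    ∀ g ∈ cliffordGates C i hi, g.ActsWithin (InUse i) := by
  intro g hg
  obtain ⟨g', _, rfl⟩ := List.mem_map.1 hg
  exact g'.actsWithin_map (inUse_loc C i hi)

theorem actsWithin_of_mem_entanglingGates (C : Circuit q n L) (i : ℕ) (hi : i < L) :
    ∀ g ∈ entanglingGates C i hi, g.ActsWithin (InUse (i + 1)) := by
  have h1 := fun j => (inUse_measuredBlock C i hi j).mono (Nat.le_succ i)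
  have h2 : ∀ j, InUse (n := n) (i + 1) (Sum.inr (⟨i, hi⟩, j)) := fun j => Nat.lt_succ_self i
  simp [entanglingGates, CliffordGate.ActsWithin, h1, h2]

theorem actsWithin_of_mem_correctionGates (i : ℕ) (hi : i < L) (β : Fin 3 → ZMod q) :
    ∀ g ∈ correctionGates (n := n) ⟨i, hi⟩ β, g.ActsWithin (InUse (i + 1)) := by
  have h2 : ∀ j, InUse (n := n) (i + 1) (Sum.inr (⟨i, hi⟩, j)) := fun j => Nat.lt_succ_self i
  simp [correctionGates, CliffordGate.ActsWithin, h2]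

end Locations

section KeyUpdates

variable {q n L d : ℕ} [Fact q.Prime]

/-- The Pauli keys `p` vanish on all blocks that satisfy `P`. -/
def VanishesOn (P : Block n L → Prop) (p : PauliKey q n L d) : Prop :=
  ∀ b, P b → p.1 b = 0 ∧ p.2 b = 0

theorem SupportedAt.vanishesOn {t : ℕ} {p : PauliKey q n L d} (h : SupportedAt t p) {i : ℕ}
    (hi : i ≤ t) : VanishesOn (InUse i) p :=
  fun b hb => h b fun ht j => ne_of_inUse hb (t := ⟨t, ht⟩) hi j

/-- A map of Pauli keys is affine, with a linear part that fixes the keys that vanish on the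
blocks that satisfy `P`. -/
def IsAffineWithin (P : Block n L → Prop) (F : PauliKey q n L d → PauliKey q n L d) : Prop :=
  ∃ (T : PauliKey q n L d →ₗ[ZMod q] PauliKey q n L d) (c : PauliKey q n L d),
    (∀ p, F p = T p + c) ∧ ∀ p, VanishesOn P p → T p = p

theorem IsAffineWithin.comp {P : Block n L → Prop} {F G : PauliKey q n L d → PauliKey q n L d}
    (hG : IsAffineWithin P G) (hF : IsAffineWithin P F) :
    IsAffineWithin P fun p => G (F p) := by
  obtain ⟨T, c, h, hT⟩ := hF
  obtain ⟨T', c', h', hT'⟩ := hG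
  refine ⟨T' ∘ₗ T, T' c + c', fun p => ?_, fun p hp => ?_⟩
  · change G (F p) = _
    rw [h', h, map_add, add_assoc, LinearMap.comp_apply]
  · rw [LinearMap.comp_apply, hT p hp, hT' p hp]

theorem IsAffineWithin.mono {P P' : Block n L → Prop} {F : PauliKey q n L d → PauliKey q n L d}
    (hF : IsAffineWithin P F) (h : ∀ b, P b → P' b) : IsAffineWithin P' F := by
  obtain ⟨T, c, hF, hT⟩ := hF
  exact ⟨T, c, hF, fun p hp => hT p fun b hb => hp b (h b hb)⟩

theorem updateKey_add (pts : EvalPoints q d) (k : SignKey d) (g : CliffordGate q (Block n L))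
    (p p' : PauliKey q n L d) :
    updateKey pts k g (p + p') + updateKey pts k g 0 = updateKey pts k g p + updateKey pts k g p' := by
  obtain ⟨x, z⟩ := p
  obtain ⟨x', z'⟩ := p'
  have h0 : (0 : PauliKey q n L d) = (0, 0) := rfl
  rw [h0]
  cases g <;> simp only [updateKey, Prod.mk_add_mk, Prod.mk.injEq] <;> constructor <;>
    funext b i <;> simp only [Pi.add_apply, Pi.zero_apply, Function.update_apply] <;>
    (try split_ifs) <;> (try simp only [Pi.add_apply, Pi.zero_apply]) <;> ring

theorem isAffineWithin_updateKey (pts : EvalPoints q d) (k : SignKey d)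
    (g : CliffordGate q (Block n L)) {P : Block n L → Prop} (hg : g.ActsWithin P) :
    IsAffineWithin P (updateKey pts k g) := by
  refine ⟨AddMonoidHom.toZModLinearMap q (AddMonoidHom.mk'
    (fun p => updateKey pts k g p - updateKey pts k g 0) fun p p' => ?_),
    updateKey pts k g 0, fun p => (sub_add_cancel _ _).symm, fun p hp => ?_⟩
  · rw [eq_sub_of_add_eq (updateKey_add pts k g p p')]
    abel
  · change updateKey pts k g p - updateKey pts k g 0 = p
    obtain ⟨x, z⟩ := p
    have hx : ∀ b, P b → x b = 0 := fun b hb => (hp b hb).1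
    have hz : ∀ b, P b → z b = 0 := fun b hb => (hp b hb).2
    have h0 : (0 : PauliKey q n L d) = (0, 0) := rfl
    rw [h0]
    cases g <;> simp only [updateKey, Prod.mk_sub_mk, Prod.mk.injEq] <;>
      simp only [CliffordGate.ActsWithin] at hg <;> constructor <;>
      funext b i <;> simp only [Pi.sub_apply, Pi.zero_apply, Function.update_apply] <;>
      (try split_ifs with hb) <;> (try subst hb) <;>
      first
      | simp [hx _ hg, hz _ hg]
      | simp [hx _ hg.1, hx _ hg.2, hz _ hg.1, hz _ hg.2]

theorem isAffineWithin_updateKeys (pts : EvalPoints q d) (k : SignKey d)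
    (gs : List (CliffordGate q (Block n L))) {P : Block n L → Prop}
    (hg : ∀ g ∈ gs, g.ActsWithin P) : IsAffineWithin P (updateKeys pts k gs) := by
  induction gs with
  | nil => exact ⟨LinearMap.id, 0, fun p => (add_zero p).symm, fun p _ => rfl⟩
  | cons g gs ih =>
    exact (ih fun g' hg' => hg g' (List.mem_cons_of_mem _ hg')).comp
      (isAffineWithin_updateKey pts k g (hg g List.mem_cons_self))

theorem isAffineWithin_currentKey (pts : EvalPoints q d) (C : Circuit q n L) (k : SignKey d)
    (i : ℕ) (hi : i ≤ L) (h : Transcript q d i) :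
    IsAffineWithin (InUse i) fun p => currentKey pts C (k, p) i hi h := by
  induction i with
  | zero => exact isAffineWithin_updateKeys pts k _ (actsWithin_of_mem_cliffordGates C 0 hi)
  | succ i ih =>
    refine (isAffineWithin_updateKeys pts k _ fun g hg => ?_).comp
      ((ih (Nat.le_of_succ_le hi) (Fin.init h)).mono fun b hb => hb.mono (Nat.le_succ i))
    rcases List.mem_append.1 hg with hg | hg
    · rcases List.mem_append.1 hg with hg | hg
      · exact actsWithin_of_mem_entanglingGates C i hi g hg
      · exact actsWithin_of_mem_correctionGates i hi _ g hg
    · exact actsWithin_of_mem_cliffordGates C (i + 1) hi g hg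

theorem updateKeys_entanglingGates_fst (pts : EvalPoints q d) (k : SignKey d) (C : Circuit q n L)
    (i : ℕ) (hi : i < L) (p : PauliKey q n L d) (j : Fin 3) :
    (updateKeys pts k (entanglingGates C i hi) p).1 (measuredBlock C i hi j) =
      ![p.1 (measuredBlock C i hi 0) - p.1 (Sum.inr (⟨i, hi⟩, 0)),
        p.1 (measuredBlock C i hi 1) - p.1 (Sum.inr (⟨i, hi⟩, 1)),
        fun l => (interpCoeff pts l)⁻¹ *
          (p.2 (measuredBlock C i hi 2) l - p.2 (Sum.inr (⟨i, hi⟩, 2)) l)] j := by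
  have hne : ∀ j j', measuredBlock C i hi j ≠ Sum.inr (⟨i, hi⟩, j') := fun j j' =>
    ne_of_inUse (inUse_measuredBlock C i hi j) le_rfl j'
  have hne' : ∀ j j', Sum.inr (⟨i, hi⟩, j') ≠ measuredBlock C i hi j := fun j j' => (hne j j').symm
  obtain ⟨x, z⟩ := p
  funext l
  fin_cases j <;>
    simp [updateKeys, entanglingGates, updateKey, hne, hne',
      (measuredBlock_injective C i hi).eq_iff, sub_eq_add_neg]

/-- The answer of the verifier is an affine function of the initial Pauli keys. Its linear part
does not depend on the keys of later Toffoli states, and depends on those of the current Toffoli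
state through the two `X`-keys and the `Z`-key that the entangling gates move to the measured
blocks. -/
theorem exists_reply_eq (pts : EvalPoints q d) (C : Circuit q n L) (k : SignKey d)
    (i : ℕ) (hi : i < L) (h : Transcript q d i) (s : Fin 3 → Word q d) :
    ∃ (f : Fin 3 → PauliKey q n L d →ₗ[ZMod q] ZMod q) (v : Fin 3 → ZMod q),
      (∀ p j, reply pts C (k, p) i hi h s j = v j + f j p) ∧
      (∀ t, i < t → ∀ p, SupportedAt t p → ∀ j, f j p = 0) ∧
      ∀ p, SupportedAt i p → ∀ j, f j p =
        ![secret pts k (p.1 (Sum.inr (⟨i, hi⟩, 0))), secret pts k (p.1 (Sum.inr (⟨i, hi⟩, 1))),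
          secret pts k (fun l => (interpCoeff pts l)⁻¹ * p.2 (Sum.inr (⟨i, hi⟩, 2)) l)] j := by
  obtain ⟨T, c, hTc, hT⟩ := isAffineWithin_currentKey pts C k i hi.le h
  obtain ⟨T', c', hTc', hT'⟩ := isAffineWithin_updateKeys pts k _
    (actsWithin_of_mem_entanglingGates C i hi)
  let D : Fin 3 → PauliKey q n L d →ₗ[ZMod q] ZMod q := fun j =>
    secret pts k ∘ₗ LinearMap.proj (measuredBlock C i hi j) ∘ₗ LinearMap.fst _ _ _ ∘ₗ T'
  have hD : ∀ p j, D j p =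
      secret pts k ((updateKeys pts k (entanglingGates C i hi) p).1 (measuredBlock C i hi j)) -
      secret pts k ((updateKeys pts k (entanglingGates C i hi) 0).1 (measuredBlock C i hi j)) := by
    intro p j
    rw [hTc', hTc', map_zero, zero_add, Prod.fst_add, Pi.add_apply, map_add, add_sub_cancel_right]
    rfl
  have h0 : ∀ j, secret pts k
      ((updateKeys pts k (entanglingGates C i hi) 0).1 (measuredBlock C i hi j)) = 0 := by
    intro j
    have : (fun _ => 0 : Word q d) = 0 := rfl
    rw [updateKeys_entanglingGates_fst]
    fin_cases j <;> simp [this]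
  refine ⟨fun j => -(D j ∘ₗ T), fun j => secret pts k (s j) - D j c, ?_, ?_, ?_⟩
  · intro p j
    have e : (fun l => s j l - (updateKeys pts k (entanglingGates C i hi)
        (currentKey pts C (k, p) i hi.le h)).1 (measuredBlock C i hi j) l) =
        s j - (updateKeys pts k (entanglingGates C i hi)
        (currentKey pts C (k, p) i hi.le h)).1 (measuredBlock C i hi j) := rfl
    have hDp := hD (currentKey pts C (k, p) i hi.le h) j
    have hcur : currentKey pts C (k, p) i hi.le h = T p + c := hTc p
    rw [h0, sub_zero] at hDp
    rw [reply, decode, interpEquiv_symm_zero, e, map_sub, ← hDp, hcur, map_add]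
    change secret pts k (s j) - (D j (T p) + D j c) = secret pts k (s j) - D j c + -D j (T p)
    ring
  · intro t ht p hp j
    have hv := hp.vanishesOn (i := i + 1) ht
    have : T' p = p := hT' p hv
    rw [LinearMap.neg_apply, LinearMap.comp_apply, hT p (hp.vanishesOn ht.le)]
    change -secret pts k ((T' p).1 (measuredBlock C i hi j)) = 0
    rw [this, (hv _ ((inUse_measuredBlock C i hi j).mono (Nat.le_succ i))).1, map_zero, neg_zero]
  · intro p hp j
    have hv := hp.vanishesOn (i := i) le_rfl
    have hm := fun j => hv _ (inUse_measuredBlock C i hi j)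
    rw [LinearMap.neg_apply, LinearMap.comp_apply, hT p hv, hD, h0, sub_zero,
      updateKeys_entanglingGates_fst]
    have hneg : (fun l => -((interpCoeff pts l)⁻¹ * p.2 (Sum.inr (⟨i, hi⟩, 2)) l) : Word q d) =
      -fun l => (interpCoeff pts l)⁻¹ * p.2 (Sum.inr (⟨i, hi⟩, 2)) l := rfl
    fin_cases j <;> simp [hm, hneg]

end KeyUpdates

/-! ### The state of the prover -/

section Blindness

variable {q n L d : ℕ} [Fact q.Prime]

/-- The indicator of the event that the answers recorded in the transcript are those of a verifier
with key `κ`. -/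
def consistent (pts : EvalPoints q d) (C : Circuit q n L) (κ : Key q n L d) :
    (i : ℕ) → i ≤ L → Transcript q d i → ℂ
  | 0, _, _ => 1
  | i + 1, hi, h =>
    if (h (Fin.last i)).2 = reply pts C κ i hi (Fin.init h) (h (Fin.last i)).1 then
      consistent pts C κ i (Nat.le_of_succ_le hi) (Fin.init h)
    else 0

/-- Conditioning on consistency with a transcript of `i` rounds keeps a twirl blind, if its
character is trivial or detects a Toffoli state that is still unused. In the inductive step the
condition on the last answer is expanded in characters; the new characters that are not trivial
detect the Toffoli state used in that round. -/
theorem sum_consistent_authenticated_eq (pts : EvalPoints q d) (C : Circuit q n L) (k : SignKey d)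
    {ρ ρ' : Matrix (Fin n → ZMod q) (Fin n → ZMod q) ℂ} (hρ : ρ.trace = ρ'.trace)
    (i : ℕ) (hi : i ≤ L) (h : Transcript q d i) (f : PauliKey q n L d →ₗ[ZMod q] ZMod q)
    (hf : f = 0 ∨ ∃ t : Fin L, i ≤ t ∧ Detects pts k f t) :
    ∑ p, (consistent pts C (k, p) i hi h * ZMod.stdAddChar (f p)) • authenticated pts (k, p) ρ =
      ∑ p, (consistent pts C (k, p) i hi h * ZMod.stdAddChar (f p)) •
        authenticated pts (k, p) ρ' := by
  induction i generalizing f with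
  | zero =>
    simp only [consistent, one_mul]
    exact sum_authenticated_eq (hf.imp_right fun ⟨t, _, ht⟩ => ⟨t, ht⟩) hρ
  | succ i ih =>
    obtain ⟨g, v, hg, hg_later, hg_now⟩ :=
      exists_reply_eq pts C k i hi (Fin.init h) (h (Fin.last i)).1
    have expand : ∀ σ : Matrix (Fin n → ZMod q) (Fin n → ZMod q) ℂ,
        ∑ p, (consistent pts C (k, p) (i + 1) hi h * ZMod.stdAddChar (f p)) •
          authenticated pts (k, p) σ =
        ∑ τ : Fin 3 → ZMod q, ((Fintype.card (Fin 3 → ZMod q) : ℂ)⁻¹ *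
            ZMod.stdAddChar (∑ j, τ j * (v j - (h (Fin.last i)).2 j))) •
          ∑ p, (consistent pts C (k, p) i (Nat.le_of_succ_le hi) (Fin.init h) *
            ZMod.stdAddChar ((f + ∑ j, τ j • g j) p)) • authenticated pts (k, p) σ := by
      intro σ
      simp_rw [Finset.smul_sum]
      rw [Finset.sum_comm]
      refine Finset.sum_congr rfl fun p _ => ?_
      simp_rw [smul_smul]
      rw [← Finset.sum_smul]
      congr 1
      have e : consistent pts C (k, p) (i + 1) hi h =
          (if reply pts C (k, p) i hi (Fin.init h) (h (Fin.last i)).1 = (h (Fin.last i)).2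
            then 1 else 0) *
          consistent pts C (k, p) i (Nat.le_of_succ_le hi) (Fin.init h) := by
        rw [consistent, ite_mul, one_mul, zero_mul]
        simp only [eq_comm]
      rw [e, ite_eq_sum_stdAddChar, Finset.mul_sum, Finset.sum_mul, Finset.sum_mul]
      refine Finset.sum_congr rfl fun τ _ => ?_
      have e2 : ∑ j, τ j * (reply pts C (k, p) i hi (Fin.init h) (h (Fin.last i)).1 j -
          (h (Fin.last i)).2 j) =
          ∑ j, τ j * (v j - (h (Fin.last i)).2 j) + (∑ j, τ j • g j) p := by
        rw [LinearMap.sum_apply, ← Finset.sum_add_distrib]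
        refine Finset.sum_congr rfl fun j _ => ?_
        rw [hg, LinearMap.smul_apply, smul_eq_mul]
        ring
      rw [e2, LinearMap.add_apply, AddChar.map_add_eq_mul, AddChar.map_add_eq_mul]
      ring
    rw [expand, expand]
    refine Finset.sum_congr rfl fun τ _ => congrArg _ (ih _ _ _ ?_)
    rcases hf with rfl | ⟨t, ht, σ, hσ, hft⟩
    · by_cases hτ : τ = 0
      · left; simp [hτ]
      · -- The sign comes from `Detects`, which states its combination with a minus.
        refine Or.inr ⟨⟨i, hi⟩, le_rfl, -τ, neg_ne_zero.2 hτ, fun p hp => ?_⟩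
        rw [zero_add, LinearMap.sum_apply, Fin.sum_univ_three]
        simp only [LinearMap.smul_apply, hg_now p hp, smul_eq_mul, Pi.neg_apply,
          Matrix.cons_val_zero, Matrix.cons_val_one, Matrix.cons_val]
        ring
    · refine Or.inr ⟨t, (Nat.lt_of_succ_le ht).le, σ, hσ, fun p hp => ?_⟩
      rw [LinearMap.add_apply, hft p hp, LinearMap.sum_apply, Finset.sum_eq_zero, add_zero]
      intro j _
      rw [LinearMap.smul_apply, hg_later t ht p hp j, smul_zero]

variable {E : Type*} [Fintype E] [DecidableEq E]

theorem exists_linearMap_conj {R S : Type*} [Fintype S] (A : Matrix S S ℂ)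
    (Φ : Matrix R R ℂ →ₗ[ℂ] Matrix S S ℂ) :
    ∃ Ψ : Matrix R R ℂ →ₗ[ℂ] Matrix S S ℂ, ∀ X, Ψ X = A * Φ X * Aᴴ :=
  ⟨{ toFun := fun X => A * Φ X * Aᴴ
     map_add' := fun X Y => by rw [map_add, Matrix.mul_add, Matrix.add_mul]
     map_smul' := fun c X => by
      rw [map_smul, Matrix.mul_smul, Matrix.smul_mul, RingHom.id_apply] }, fun _ => rfl⟩

theorem exists_linearMap_kronecker (R : Type*) {S : Type*} (B : Matrix S S ℂ) :
    ∃ Ψ : Matrix R R ℂ →ₗ[ℂ] Matrix (R × S) (R × S) ℂ, ∀ X, Ψ X = X ⊗ₖ B :=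
  ⟨{ toFun := fun X => X ⊗ₖ B
     map_add' := fun X Y => Matrix.add_kronecker X Y B
     map_smul' := fun c X => Matrix.smul_kronecker c X B }, fun _ => rfl⟩

/-- For a fixed transcript the prover acts linearly on the state that he receives, and his action
does not depend on the key. -/
theorem exists_runWithKey_eq (pts : EvalPoints q d) (C : Circuit q n L) (V : Strategy q n L d E)
    (ρE : Matrix E E ℂ) (i : ℕ) (hi : i ≤ L) (h : Transcript q d i) :
    ∃ Φ : Matrix (Reg q n L d) (Reg q n L d) ℂ →ₗ[ℂ]
        Matrix (Reg q n L d × E) (Reg q n L d × E) ℂ,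
      ∀ ρ κ, runWithKey pts C V ρE ρ κ i hi h =
        consistent pts C κ i hi h • Φ (authenticated pts κ ρ) := by
  induction i with
  | zero =>
    obtain ⟨Φ, hΦ⟩ := exists_linearMap_kronecker (Reg q n L d) ρE
    obtain ⟨Ψ, hΨ⟩ := exists_linearMap_conj (V 0 h).1 Φ
    refine ⟨Ψ, fun ρ κ => ?_⟩
    rw [consistent, one_smul, hΨ, hΦ, runWithKey]
  | succ i ih =>
    obtain ⟨Φ, hΦ⟩ := ih (Nat.le_of_succ_le hi) (Fin.init h)
    obtain ⟨Φ', hΦ'⟩ := exists_linearMap_conj (measureProj C i hi (h (Fin.last i)).1) Φ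
    obtain ⟨Ψ, hΨ⟩ := exists_linearMap_conj (V (i + 1) h).1 Φ'
    refine ⟨Ψ, fun ρ κ => ?_⟩
    rw [runWithKey, consistent]
    split_ifs
    · rw [hΦ, hΨ, hΦ', Matrix.mul_smul, Matrix.smul_mul, Matrix.mul_smul, Matrix.smul_mul]
    · rw [zero_smul]

theorem proverState_eq_of_trace_eq (pts : EvalPoints q d) (C : Circuit q n L)
    (V : Strategy q n L d E) (ρE : Matrix E E ℂ)
    {ρ ρ' : Matrix (Fin n → ZMod q) (Fin n → ZMod q) ℂ} (hρ : ρ.trace = ρ'.trace)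
    (i : ℕ) (hi : i ≤ L) (h : Transcript q d i) :
    proverState pts C V ρE ρ i hi h = proverState pts C V ρE ρ' i hi h := by
  obtain ⟨Φ, hΦ⟩ := exists_runWithKey_eq pts C V ρE i hi h
  have hsum : ∀ σ : Matrix (Fin n → ZMod q) (Fin n → ZMod q) ℂ, proverState pts C V ρE σ i hi h =
      (Fintype.card (Key q n L d) : ℂ)⁻¹ •
        Φ (∑ κ, consistent pts C κ i hi h • authenticated pts κ σ) := by
    intro σ
    rw [proverState, map_sum]
    refine congrArg _ (Finset.sum_congr rfl fun κ _ => ?_)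
    rw [hΦ, map_smul]
  have key : ∑ κ : Key q n L d, consistent pts C κ i hi h • authenticated pts κ ρ =
      ∑ κ : Key q n L d, consistent pts C κ i hi h • authenticated pts κ ρ' := by
    rw [Fintype.sum_prod_type, Fintype.sum_prod_type]
    refine Finset.sum_congr rfl fun k _ => ?_
    have := sum_consistent_authenticated_eq pts C k hρ i hi h 0 (Or.inl rfl)
    simp only [LinearMap.zero_apply, AddChar.map_zero_eq_one, mul_one] at this
    exact this
  rw [hsum, hsum, key]

end Blindness

end PolyQPIP

end

theorem mainTheorem9 {q n L d : ℕ} [Fact q.Prime] [NeZero n]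
    (pts : PolyQPIP.EvalPoints q d) (C : PolyQPIP.Circuit q n L)
    {E : Type*} [Fintype E] [DecidableEq E]
    (ρE : Matrix E E ℂ) (hρE : PolyQPIP.IsDensity ρE)
    (V : PolyQPIP.Strategy q n L d E)
    (ρ ρ' : Matrix (Fin n → ZMod q) (Fin n → ZMod q) ℂ)
    (hρ : PolyQPIP.IsDensity ρ) (hρ' : PolyQPIP.IsDensity ρ') :
    (∀ (i : ℕ) (hi : i ≤ L) (h : PolyQPIP.Transcript q d i),
      PolyQPIP.proverState pts C V ρE ρ i hi h = PolyQPIP.proverState pts C V ρE ρ' i hi h) ∧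
    (∀ (i : ℕ) (hi : i < L) (h : PolyQPIP.Transcript q d i) (s : Fin 3 → PolyQPIP.Word q d),
      PolyQPIP.proverStateSent pts C V ρE ρ i hi h s =
        PolyQPIP.proverStateSent pts C V ρE ρ' i hi h s) ∧
    (∀ (h : PolyQPIP.Transcript q d L) (s : PolyQPIP.Word q d),
      PolyQPIP.proverStateFinal pts C V ρE ρ h s =
        PolyQPIP.proverStateFinal pts C V ρE ρ' h s) := by
  have htr : ρ.trace = ρ'.trace := hρ.2.trans hρ'.2.symm
  have key := fun i hi h => PolyQPIP.proverState_eq_of_trace_eq pts C V ρE htr i hi h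
  refine ⟨key, fun i hi h s => ?_, fun h s => ?_⟩
  · rw [PolyQPIP.proverStateSent, PolyQPIP.proverStateSent, key]
  · rw [PolyQPIP.proverStateFinal, PolyQPIP.proverStateFinal, key]
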